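/- **Definitions.** A *state* is a sequence $\rho=(\rho_n)_{n\ge 1}$ where $\rho_n$ is a density matrix (positive semidefinite, trace $1$) on $\mathbb C^{2^n}$ and, for $n>1$, tracing out the last qubit of $\rho_n$ gives $\rho_{n-1}$. A *special projection* is a Hermitian projection $G$ on some $\mathbb C^{2^n}$ with complex algebraic entries; put $\tau(G)=2^{-n}\operatorname{Tr}G$ and $\rho(G)=\operatorname{Tr}(\rho_nG)$. A sequence of matrices with complex algebraic entries is *computable* if their sizes, and codes of their entries, are given by a computable function, where an algebraic number $z$ is coded by a nonzero integer polynomial with root $z$ together with a disc with rational centre and radius that contains $z$ and no other root of the polynomial. A state is *computable* if all $\rho_n$ have complex algebraic entries and the sequence $(\rho_n)_n$ is computable. A *quantum Schnorr test* is a computable sequence $(S^m)_m$ of special projections (possibly on different numbers of qubits) such that $\sum_m\tau(S^m)$ converges to a computable real number. The state $\rho$ is *quantum Schnorr random* if for every quantum Schnorr test $(S^m)_m$ and every $\delta>0$ there are only finitely many $m$ with $\rho(S^m)>\delta$. The state $\rho$ is *strong quantum random* if for every (not necessarily computable) sequence $(T^m)_m$ of special projections with $\lim_m\tau(T^m)=0$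 and every $\delta>0$ there is an $m$ with $\rho(T^m)\le\delta$. Let $\alpha^n_1\ge\dots\ge\alpha^n_{2^n}$ be the eigenvalues of $\rho_n$ with multiplicity, and let $\mathcal F^\rho=(f^\rho_n)_{n\ge1}$, where $f^\rho_n$ is the function on $[0,1)$ equal to $2^n\alpha^n_i$ on $[(i-1)2^{-n},i2^{-n})$ for $1\le i\le 2^n$. A family $\mathcal F$ of functions on $[0,1)$ with Lebesgue measure $\mu$ is *uniformly integrable* if every $f\in\mathcal F$ is in $L^1([0,1),\mu)$ and for every $\delta>0$ there is an $\epsilon>0$ such that $\sup_{f\in\mathcal F}\bigl|\int_S f\,d\mu\bigr|<\delta$ for every measurable $S\subseteq[0,1)$ with $\mu(S)\le\epsilon$. **Theorem 7.1.** (1) A computable state $\rho$ is quantum Schnorr random if and only if $\mathcal F^\rho$ is uniformly integrable. (2) For an arbitrary state $\rho$, if $\mathcal F^\rho$ is uniformly integrable, then $\rho$ is strong quantum random and quantum Schnorr random. -/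

import Mathlib

namespace QRandom

open MeasureTheory Filter Topology
open scoped ComplexOrder

/-! ### Coding of rational and complex algebraic numbers by natural numbers

Computability is Mathlib's `Computable`, on tuples and lists of natural numbers. -/

/-- A code `(a, b, c)` of the rational number `(a - b) / (c + 1)`. -/
abbrev RatCode : Type := ℕ × ℕ × ℕ

/-- The rational number with code `q`. -/
def RatCode.val (q : RatCode) : ℚ := ((q.1 : ℚ) - (q.2.1 : ℚ)) / ((q.2.2 : ℚ) + 1)

/-- The integer polynomial whose coefficients, constant term first, are the differences
`a - b` of the pairs `(a, b)` of a list. -/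
noncomputable def polyOfList : List (ℕ × ℕ) → Polynomial ℤ
  | [] => 0
  | a :: l => Polynomial.C ((a.1 : ℤ) - (a.2 : ℤ)) + Polynomial.X * polyOfList l

/-- A code of a complex algebraic number: an integer polynomial, the real and the imaginary part
of a rational centre, and a rational radius. -/
abbrev AlgCode : Type := List (ℕ × ℕ) × (RatCode × RatCode) × RatCode

/-- The polynomial of a code. -/
noncomputable def AlgCode.poly (c : AlgCode) : Polynomial ℤ := polyOfList c.1

/-- The centre of a code, a Gaussian rational. -/
noncomputable def AlgCode.centre (c : AlgCode) : ℂ := ⟨(c.2.1.1.val : ℝ), (c.2.1.2.val : ℝ)⟩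

/-- The radius of a code. -/
noncomputable def AlgCode.radius (c : AlgCode) : ℝ := (c.2.2.val : ℝ)

/-- The code `c` represents `z`: the polynomial of `c` is not zero, and `z` is the one and only
root of it in the open disc given by `c`. This is the usual computable presentation of the field
of complex algebraic numbers: every code represents at most one number, every algebraic number has
a code, and equality, the field operations and complex conjugation are computable on codes. -/
def AlgCode.Represents (c : AlgCode) (z : ℂ) : Prop :=
  c.poly ≠ 0 ∧ Polynomial.aeval z c.poly = 0 ∧ ‖z - c.centre‖ < c.radius ∧
    ∀ w : ℂ, Polynomial.aeval w c.poly = 0 → ‖w - c.centre‖ < c.radius → w = z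

/-- A real number is computable if a computable sequence `φ` of rationals satisfies
`|r - φ n| ≤ 2⁻ⁿ` for all `n`. -/
def IsComputableReal (r : ℝ) : Prop :=
  ∃ φ : ℕ → RatCode, Computable φ ∧ ∀ n, |r - ((φ n).val : ℝ)| ≤ (2 : ℝ)⁻¹ ^ n

/-! ### Matrices on qubits -/

/-- Matrices on `ℂ^(2^n)`. The index `∑ k, b k * 2 ^ (n - 1 - k)` belongs to the computational
basis vector `b 0, …, b (n - 1)`, so that the last qubit is the lowest binary digit. -/
abbrev QMat (n : ℕ) : Type := Matrix (Fin (2 ^ n)) (Fin (2 ^ n)) ℂ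

/-- A computable sequence of matrices with complex algebraic entries: the numbers of qubits are
computable, and codes of the entries are computable from the index `m` of the matrix and the
row and the column of the entry. (It is of no importance what the codes are outside the matrix.) -/
def IsComputableMatSeq (k : ℕ → ℕ) (A : ∀ m, QMat (k m)) : Prop :=
  Computable k ∧ ∃ code : ℕ × ℕ × ℕ → AlgCode, Computable code ∧
    ∀ (m : ℕ) (i j : Fin (2 ^ k m)), (code (m, (i : ℕ), (j : ℕ))).Represents (A m i j)

/-- Appending the bit `b`, as last qubit, to the index `i`. -/
def appendBit {n : ℕ} (i : Fin (2 ^ n)) (b : Fin 2) : Fin (2 ^ (n + 1)) :=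
  ⟨2 * i + b, by have := i.isLt; have := b.isLt; rw [pow_succ]; omega⟩

/-- The partial trace over the last qubit. -/
def ptraceLast {n : ℕ} (A : QMat (n + 1)) : QMat n :=
  fun i j => ∑ b : Fin 2, A (appendBit i b) (appendBit j b)

/-! ### States -/

/-- A state: a coherent sequence of density matrices, where `mat n` describes the first `n` qubits.
The component `mat 0` carries no information: it is the `1 × 1` matrix with entry `1`. -/
structure QState where
  mat : ∀ n : ℕ, QMat n
  posSemidef : ∀ n, (mat n).PosSemidef
  trace_eq_one : ∀ n, (mat n).trace = 1
  ptrace_eq : ∀ n, ptraceLast (mat (n + 1)) = mat n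

/-- A state is computable if its density matrices are a computable sequence of matrices with
complex algebraic entries. -/
def QState.IsComputable (ρ : QState) : Prop := IsComputableMatSeq (fun n => n) ρ.mat

/-- The eigenvalues of the `n`-th density matrix, with multiplicity, in non-increasing order
(counted from `0`). -/
noncomputable def QState.eig (ρ : QState) (n : ℕ) (i : Fin (2 ^ n)) : ℝ :=
  (ρ.posSemidef n).isHermitian.eigenvalues₀ (Fin.cast (Fintype.card_fin _).symm i)

/-- The step function on `[0, 1)` that takes the value `2^n` times the `i`-th largest eigenvalue of
the `n`-th density matrix on the `i`-th of the `2^n` half-open intervals of length `2⁻ⁿ`.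
It is continued by `0` outside `[0, 1)`. -/
noncomputable def QState.stepFun (ρ : QState) (n : ℕ) (x : ℝ) : ℝ :=
  ∑ i : Fin (2 ^ n),
    Set.indicator (Set.Ico ((i : ℝ) / 2 ^ n) (((i : ℝ) + 1) / 2 ^ n))
      (fun _ => 2 ^ n * ρ.eig n i) x

/-- Uniform integrability on `[0, 1)` with Lebesgue measure. -/
def UniformlyIntegrableUnit {ι : Type*} (f : ι → ℝ → ℝ) : Prop :=
  (∀ i, IntegrableOn (f i) (Set.Ico 0 1) volume) ∧
    ∀ δ : ℝ, 0 < δ → ∃ ε : ℝ, 0 < ε ∧ ∀ S : Set ℝ, S ⊆ Set.Ico 0 1 → MeasurableSet S →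
      volume S ≤ ENNReal.ofReal ε →
        (⨆ i, ENNReal.ofReal |∫ x in S, f i x|) < ENNReal.ofReal δ

/-- The family of the step functions of the density matrices on `1, 2, 3, …` qubits. -/
noncomputable def QState.family (ρ : QState) : ℕ → ℝ → ℝ := fun n => ρ.stepFun (n + 1)

/-! ### Tests and randomness -/

/-- A special projection: a Hermitian projection on some `ℂ^(2^n)` with complex algebraic
entries. -/
structure SpecialProjection where
  qubits : ℕ
  mat : QMat qubits
  isStarProjection : IsStarProjection mat
  isAlgebraic : ∀ i j, IsAlgebraic ℚ (mat i j)

/-- `τ(G)`, that is `2⁻ⁿ Tr G`, for a projection `G` on `ℂ^(2^n)`. -/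
noncomputable def SpecialProjection.tau (G : SpecialProjection) : ℝ :=
  G.mat.trace.re / 2 ^ G.qubits

/-- `ρ(G)`, that is the (real) number `Tr (ρ_n G)`, for a projection `G` on `ℂ^(2^n)`. -/
noncomputable def QState.prob (ρ : QState) (G : SpecialProjection) : ℝ :=
  (ρ.mat G.qubits * G.mat).trace.re

/-- A quantum Schnorr test: a computable sequence of special projections for which the series of
the `τ(S m)` converges to a computable real number. -/
structure IsQSTest (S : ℕ → SpecialProjection) : Prop where
  computable : IsComputableMatSeq (fun m => (S m).qubits) (fun m => (S m).mat)
  sum_computable : ∃ r : ℝ, HasSum (fun m => (S m).tau) r ∧ IsComputableReal r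

/-- The state `ρ` fails `S` at order `δ`. -/
def QState.FailsAt (ρ : QState) (S : ℕ → SpecialProjection) (δ : ℝ) : Prop :=
  {m : ℕ | δ < ρ.prob (S m)}.Infinite

/-- Quantum Schnorr randomness: all quantum Schnorr tests are passed at all orders. -/
def QState.IsQuantumSchnorrRandom (ρ : QState) : Prop :=
  ∀ S : ℕ → SpecialProjection, IsQSTest S → ∀ δ : ℝ, 0 < δ → ¬ ρ.FailsAt S δ

/-- A quantum null condition: special projections with `τ(T m) → 0`, without any computability. -/
def IsQuantumNullCondition (T : ℕ → SpecialProjection) : Prop :=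
  Tendsto (fun m => (T m).tau) atTop (𝓝 0)

/-- Strong quantum randomness: `inf_m ρ(T m) = 0` for all quantum null conditions `T`. -/
def QState.IsStrongQuantumRandom (ρ : QState) : Prop :=
  ∀ T : ℕ → SpecialProjection, IsQuantumNullCondition T →
    ∀ δ : ℝ, 0 < δ → ∃ m, ρ.prob (T m) ≤ δ

end QRandom

/-! Everything passes through the spectral tails: `ρ.tail n t` is the total weight of the
eigenvalues of `ρ_n` above `2⁻ⁿ t`, and `HasSmallTails` says that for each `δ` a single `t` makes
all tails smaller than `δ`. Since `f_n` takes the value `2ⁿ α_i` on a cell of length `2⁻ⁿ`, this is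
the usual tail form of uniform integrability (`uniformlyIntegrable_iff_hasSmallTails`).

Small tails imply randomness, with no computability involved. In an eigenbasis of `ρ_n` the diagonal
of a projection `G` lies in `[0, 1]`, so cutting the spectrum at `t` gives `ρ(G) ≤ tail n t + t
τ(G)` (`prob_le`). Hence `τ(T m) → 0` forces `ρ(T m) → 0`, which is more than either kind of
randomness asks.

Conversely, let `ρ` be computable with tails at least `δ > 0` at every height `t`. The projection
onto the eigenvectors with eigenvalue above `2⁻ⁿ t` has `τ ≤ 1/t` by Markov's inequality, and its
probability is the tail. Perturbing the eigenvectors gives a projection of the same rank with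
Gaussian rational entries and probability above a rational `q < δ` (`exists_gaussRat_projection`).
For such matrices the projection equations and the trace bound are decidable, and `q < Tr (ρ_n P)`
is confirmed by a good enough approximation of `ρ_n`. Unbounded search with `t = 2^m` therefore
yields a computable sequence with `τ ≤ 2⁻ᵐ`, whose sum is a computable real: a Schnorr test that `ρ`
fails at order `q`. -/

namespace QRandom

open MeasureTheory Filter Topology
open scoped ComplexOrder

/-! ### Computable arithmetic, decidable predicates and unbounded search. -/

section Computability

variable {α β : Type*} [Primcodable α] [Primcodable β]

theorem computable_nat_add {f g : α → ℕ} (hf : Computable f) (hg : Computable g) :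
    Computable fun x => f x + g x := Primrec.nat_add.to_comp.comp hf hg

theorem computable_nat_mul {f g : α → ℕ} (hf : Computable f) (hg : Computable g) :
    Computable fun x => f x * g x := Primrec.nat_mul.to_comp.comp hf hg

theorem computable_two_pow {f : α → ℕ} (hf : Computable f) : Computable fun x => 2 ^ f x := by
  have h : Computable fun x => Nat.rec (motive := fun _ => ℕ) 1 (fun _ r => r * 2) (f x) :=
    Computable.nat_rec hf (Computable.const 1)
      (computable_nat_mul (Computable.snd.comp Computable.snd) (Computable.const 2)).to₂
  refine h.of_eq fun x => ?_
  induction f x with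
  | zero => rfl
  | succ n ih => rw [pow_succ, ← ih]

theorem computablePred_lt {f g : α → ℕ} (hf : Computable f) (hg : Computable g) :
    ComputablePred fun x => f x < g x :=
  Computable.computablePred (Primrec.nat_lt.decide.to_comp.comp hf hg)

theorem computablePred_comp {p : β → Prop} (hp : ComputablePred p) {f : α → β}
    (hf : Computable f) : ComputablePred fun x => p (f x) := by
  obtain ⟨_, h⟩ := hp
  exact ⟨inferInstance, h.comp hf⟩

theorem computablePred_and {p q : α → Prop} (hp : ComputablePred p) (hq : ComputablePred q) :
    ComputablePred fun x => p x ∧ q x := by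
  obtain ⟨_, hp⟩ := hp
  obtain ⟨_, hq⟩ := hq
  exact ⟨inferInstance, (Primrec.and.to_comp.comp hp hq).of_eq fun x => by simp⟩

theorem computablePred_forall_lt {p : α → ℕ → Prop}
    (hp : ComputablePred fun x : α × ℕ => p x.1 x.2) {N : α → ℕ}
    (hN : Computable N) : ComputablePred fun x => ∀ i < N x, p x i := by
  classical
  have hp' := hp.decide
  have h : Computable fun x => Nat.rec (motive := fun _ => Bool) true
      (fun i r => r && decide (p x i)) (N x) :=
    Computable.nat_rec hN (Computable.const true)
      (Primrec.and.to_comp.comp (Computable.snd.comp Computable.snd)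
        (hp'.comp (Computable.pair Computable.fst (Computable.fst.comp Computable.snd)))).to₂
  refine ⟨inferInstance, h.of_eq fun x => ?_⟩
  rw [Bool.eq_iff_iff, decide_eq_true_iff]
  beta_reduce
  generalize N x = n
  induction n with
  | zero => simp
  | succ n ih =>
    simp only [Bool.and_eq_true, decide_eq_true_eq, ih]
    exact Nat.forall_lt_succ_right.symm

/-- Unbounded search for a witness in a nonempty coded type. -/
theorem exists_computable_choice [Inhabited β] {p : α → β → Prop}
    (hp : ComputablePred fun x : α × β => p x.1 x.2) (h : ∀ x, ∃ y, p x y) :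
    ∃ f : α → β, Computable f ∧ ∀ x, p x (f x) := by
  classical
  -- Numbers that decode to nothing become `default`. This is harmless, since `p` is tested on the
  -- decoded value itself and each `y` is reached from its own code.
  let d : ℕ → β := fun n => (Encodable.decode (α := β) n).getD default
  have hd : Computable d := Computable.option_getD Computable.decode (Computable.const _)
  have hP : ComputablePred fun x : α × ℕ => p x.1 (d x.2) :=
    computablePred_comp hp (Computable.pair Computable.fst (hd.comp Computable.snd))
  have hex : ∀ x, ∃ n, p x (d n) := fun x => by
    obtain ⟨y, hy⟩ := h x
    exact ⟨Encodable.encode y, by simpa [d] using hy⟩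
  exact ⟨fun x => d (Nat.find (hex x)), hd.comp (Computable.find hP hex),
    fun x => Nat.find_spec (hex x)⟩

/-! ### Exact computation with Gaussian rationals. -/

/-- A code `((a, b), (c, d), e)` of the Gaussian rational `((a - b) + (c - d) i) / (e + 1)`. -/
abbrev GaussCode : Type := (ℕ × ℕ) × (ℕ × ℕ) × ℕ

namespace GaussCode

/-- The Gaussian rational with code `c`. -/
noncomputable def val (c : GaussCode) : ℂ :=
  (((c.1.1 : ℂ) - c.1.2) + ((c.2.1.1 : ℂ) - c.2.1.2) * Complex.I) / ((c.2.2 : ℂ) + 1)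

/-- Addition of codes. -/
def add (x y : GaussCode) : GaussCode :=
  ((x.1.1 * (y.2.2 + 1) + y.1.1 * (x.2.2 + 1), x.1.2 * (y.2.2 + 1) + y.1.2 * (x.2.2 + 1)),
    (x.2.1.1 * (y.2.2 + 1) + y.2.1.1 * (x.2.2 + 1),
      x.2.1.2 * (y.2.2 + 1) + y.2.1.2 * (x.2.2 + 1)),
    x.2.2 * y.2.2 + x.2.2 + y.2.2)

/-- Multiplication of codes. -/
def mul (x y : GaussCode) : GaussCode :=
  ((x.1.1 * y.1.1 + x.1.2 * y.1.2 + (x.2.1.1 * y.2.1.2 + x.2.1.2 * y.2.1.1),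
      x.1.1 * y.1.2 + x.1.2 * y.1.1 + (x.2.1.1 * y.2.1.1 + x.2.1.2 * y.2.1.2)),
    (x.1.1 * y.2.1.1 + x.1.2 * y.2.1.2 + (x.2.1.1 * y.1.1 + x.2.1.2 * y.1.2),
      x.1.1 * y.2.1.2 + x.1.2 * y.2.1.1 + (x.2.1.1 * y.1.2 + x.2.1.2 * y.1.1)),
    x.2.2 * y.2.2 + x.2.2 + y.2.2)

/-- Complex conjugation of codes. -/
def conj (x : GaussCode) : GaussCode := (x.1, (x.2.1.2, x.2.1.1), x.2.2)

theorem den_ne_zero (n : ℕ) : (n : ℂ) + 1 ≠ 0 := Nat.cast_add_one_ne_zero n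

theorem val_add (x y : GaussCode) : (x.add y).val = x.val + y.val := by
  -- Denominators are stored minus one, so the product of `a + 1` and `b + 1` is stored as `ab + a +
  -- b`.
  have h : ((x.2.2 * y.2.2 + x.2.2 + y.2.2 : ℕ) : ℂ) + 1 = (x.2.2 + 1) * (y.2.2 + 1) := by
    push_cast; ring
  have h1 := den_ne_zero x.2.2
  have h2 := den_ne_zero y.2.2
  simp only [val, add, h]
  push_cast
  field_simp
  ring

theorem val_mul (x y : GaussCode) : (x.mul y).val = x.val * y.val := by
  have h : ((x.2.2 * y.2.2 + x.2.2 + y.2.2 : ℕ) : ℂ) + 1 = (x.2.2 + 1) * (y.2.2 + 1) := by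
    push_cast; ring
  simp only [val, mul, h]
  rw [div_mul_div_comm]
  congr 1
  push_cast
  linear_combination (-((x.2.1.1 : ℂ) - x.2.1.2) * ((y.2.1.1 : ℂ) - y.2.1.2)) * Complex.I_sq

theorem val_conj (x : GaussCode) : x.conj.val = (starRingEnd ℂ) x.val := by
  simp only [val, conj, map_div₀, map_add, map_mul, map_sub, Complex.conj_natCast, Complex.conj_I,
    map_one]
  congr 1
  ring

theorem val_re (x : GaussCode) : x.val.re = ((x.1.1 : ℝ) - x.1.2) / (x.2.2 + 1) := by
  have : x.val = (((x.1.1 : ℝ) - x.1.2) / (x.2.2 + 1) : ℝ) +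
      (((x.2.1.1 : ℝ) - x.2.1.2) / (x.2.2 + 1) : ℝ) * Complex.I := by
    simp only [val]; push_cast; ring
  rw [this]; simp only [Complex.add_re, Complex.ofReal_re, Complex.re_ofReal_mul, Complex.I_re]
  ring

theorem val_im (x : GaussCode) : x.val.im = ((x.2.1.1 : ℝ) - x.2.1.2) / (x.2.2 + 1) := by
  have : x.val = (((x.1.1 : ℝ) - x.1.2) / (x.2.2 + 1) : ℝ) +
      (((x.2.1.1 : ℝ) - x.2.1.2) / (x.2.2 + 1) : ℝ) * Complex.I := by
    simp only [val]; push_cast; ring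
  rw [this]; simp only [Complex.add_im, Complex.ofReal_im, Complex.im_ofReal_mul, Complex.I_im]
  ring

theorem exists_val_eq (p q : ℚ) : ∃ c : GaussCode, c.val = (p : ℂ) + (q : ℂ) * Complex.I := by
  have key : ∀ r : ℚ, ∃ c : GaussCode, c.val = (r : ℂ) := fun r => by
    refine ⟨((r.num.toNat, (-r.num).toNat), (0, 0), r.den - 1), ?_⟩
    have h1 : ((r.num.toNat : ℂ) - ((-r.num).toNat : ℂ)) = (r.num : ℂ) := by
      exact_mod_cast congrArg (Int.cast (R := ℂ)) (Int.toNat_sub_toNat_neg r.num)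
    have h2 : ((r.den - 1 : ℕ) : ℂ) + 1 = r.den := by
      exact_mod_cast Nat.sub_add_cancel r.pos
    simp only [val, h1, h2]
    conv_rhs => rw [Rat.cast_def]
    simp
  obtain ⟨a, ha⟩ := key p
  obtain ⟨b, hb⟩ := key q
  refine ⟨a.add (b.mul ((0, 0), (1, 0), 0)), ?_⟩
  rw [val_add, val_mul, ha, hb]
  simp [val]

theorem computable_components {f : α → GaussCode} (hf : Computable f) :
    (Computable fun x => (f x).1.1) ∧ (Computable fun x => (f x).1.2) ∧
      (Computable fun x => (f x).2.1.1) ∧ (Computable fun x => (f x).2.1.2) ∧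
      Computable fun x => (f x).2.2 :=
  ⟨.comp .fst (.comp .fst hf), .comp .snd (.comp .fst hf),
    .comp .fst (.comp .fst (.comp .snd hf)), .comp .snd (.comp .fst (.comp .snd hf)),
    .comp .snd (.comp .snd hf)⟩

theorem computable_add {f g : α → GaussCode} (hf : Computable f) (hg : Computable g) :
    Computable fun x => (f x).add (g x) := by
  obtain ⟨f1, f2, f3, f4, f5⟩ := computable_components hf
  obtain ⟨g1, g2, g3, g4, g5⟩ := computable_components hg
  unfold add
  repeat' first
    | exact f1 | exact f2 | exact f3 | exact f4 | exact f5
    | exact g1 | exact g2 | exact g3 | exact g4 | exact g5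
    | exact Computable.const 1
    | apply Computable.pair | apply computable_nat_add | apply computable_nat_mul

theorem computable_mul {f g : α → GaussCode} (hf : Computable f) (hg : Computable g) :
    Computable fun x => (f x).mul (g x) := by
  obtain ⟨f1, f2, f3, f4, f5⟩ := computable_components hf
  obtain ⟨g1, g2, g3, g4, g5⟩ := computable_components hg
  unfold mul
  repeat' first
    | exact f1 | exact f2 | exact f3 | exact f4 | exact f5
    | exact g1 | exact g2 | exact g3 | exact g4 | exact g5
    | apply Computable.pair | apply computable_nat_add | apply computable_nat_mul

theorem computable_conj {f : α → GaussCode} (hf : Computable f) :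
    Computable fun x => (f x).conj := by
  obtain ⟨f1, f2, f3, f4, f5⟩ := computable_components hf
  exact .pair (.pair f1 f2) (.pair (.pair f4 f3) f5)

end GaussCode

/-- A computable function with values in the Gaussian rationals. -/
def GaussComputable (f : α → ℂ) : Prop :=
  ∃ c : α → GaussCode, Computable c ∧ ∀ x, (c x).val = f x

namespace GaussComputable

theorem of_eq {f g : α → ℂ} (hf : GaussComputable f) (h : ∀ x, f x = g x) : GaussComputable g :=
  (funext h : f = g) ▸ hf

theorem comp {f : β → ℂ} (hf : GaussComputable f) {g : α → β} (hg : Computable g) :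
    GaussComputable fun x => f (g x) := by
  obtain ⟨c, hc, h⟩ := hf
  exact ⟨fun x => c (g x), hc.comp hg, fun x => h _⟩

theorem const (p q : ℚ) : GaussComputable fun _ : α => (p : ℂ) + (q : ℂ) * Complex.I := by
  obtain ⟨c, hc⟩ := GaussCode.exists_val_eq p q
  exact ⟨fun _ => c, Computable.const c, fun _ => hc⟩

theorem const_rat (p : ℚ) : GaussComputable fun _ : α => (p : ℂ) :=
  (const p 0).of_eq fun _ => by simp

theorem natCast {f : α → ℕ} (hf : Computable f) : GaussComputable fun x => (f x : ℂ) :=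
  ⟨fun x => ((f x, 0), (0, 0), 0),
    .pair (.pair hf (.const 0)) (.const ((0, 0), 0)), fun x => by simp [GaussCode.val]⟩

theorem add {f g : α → ℂ} (hf : GaussComputable f) (hg : GaussComputable g) :
    GaussComputable fun x => f x + g x := by
  obtain ⟨c, hc, h⟩ := hf
  obtain ⟨d, hd, h'⟩ := hg
  exact ⟨_, GaussCode.computable_add hc hd, fun x => by rw [GaussCode.val_add, h, h']⟩

theorem mul {f g : α → ℂ} (hf : GaussComputable f) (hg : GaussComputable g) :
    GaussComputable fun x => f x * g x := by
  obtain ⟨c, hc, h⟩ := hf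
  obtain ⟨d, hd, h'⟩ := hg
  exact ⟨_, GaussCode.computable_mul hc hd, fun x => by rw [GaussCode.val_mul, h, h']⟩

theorem conj {f : α → ℂ} (hf : GaussComputable f) :
    GaussComputable fun x => (starRingEnd ℂ) (f x) := by
  obtain ⟨c, hc, h⟩ := hf
  exact ⟨_, GaussCode.computable_conj hc, fun x => by rw [GaussCode.val_conj, h]⟩

theorem sub {f g : α → ℂ} (hf : GaussComputable f) (hg : GaussComputable g) :
    GaussComputable fun x => f x - g x :=
  (hf.add ((const_rat (-1)).mul hg)).of_eq fun x => by push_cast; ring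

theorem normSq {f : α → ℂ} (hf : GaussComputable f) :
    GaussComputable fun x => ((Complex.normSq (f x) : ℝ) : ℂ) :=
  (hf.mul hf.conj).of_eq fun _ => Complex.mul_conj _

theorem re {f : α → ℂ} (hf : GaussComputable f) :
    GaussComputable fun x => (((f x).re : ℝ) : ℂ) :=
  ((const_rat (1 / 2)).mul (hf.add hf.conj)).of_eq fun x => by
    rw [Complex.add_conj]; push_cast; ring

theorem sum {f : α → ℕ → ℂ} (hf : GaussComputable fun x : α × ℕ => f x.1 x.2) {N : α → ℕ}
    (hN : Computable N) : GaussComputable fun x => ∑ i ∈ Finset.range (N x), f x i := by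
  obtain ⟨c, hc, h⟩ := hf
  refine ⟨fun x => Nat.rec (motive := fun _ => GaussCode) ((0, 0), (0, 0), 0)
    (fun i r => r.add (c (x, i))) (N x), Computable.nat_rec hN (Computable.const _)
      (GaussCode.computable_add (Computable.snd.comp Computable.snd)
        (hc.comp (Computable.pair Computable.fst (Computable.fst.comp Computable.snd)))).to₂,
    fun x => ?_⟩
  beta_reduce
  generalize N x = n
  induction n with
  | zero => simp [GaussCode.val]
  | succ n ih => simp only [Finset.sum_range_succ, GaussCode.val_add, h, ih]

theorem pow {f : α → ℂ} (hf : GaussComputable f) {N : α → ℕ} (hN : Computable N) :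
    GaussComputable fun x => f x ^ N x := by
  obtain ⟨c, hc, h⟩ := hf
  refine ⟨fun x => Nat.rec (motive := fun _ => GaussCode) ((1, 0), (0, 0), 0)
    (fun _ r => r.mul (c x)) (N x), Computable.nat_rec hN (Computable.const _)
      (GaussCode.computable_mul (Computable.snd.comp Computable.snd)
        (hc.comp Computable.fst)).to₂, fun x => ?_⟩
  beta_reduce
  generalize N x = n
  induction n with
  | zero => simp [GaussCode.val]
  | succ n ih => simp only [pow_succ, GaussCode.val_mul, h, ih]

/-- The stored denominator is positive, so the sign of the real part is a comparison of two natural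
numbers. All decidability of order and equality below reduces to this. -/
theorem re_pos {f : α → ℂ} (hf : GaussComputable f) : ComputablePred fun x => 0 < (f x).re := by
  obtain ⟨c, hc, h⟩ := hf
  obtain ⟨h1, h2, -⟩ := GaussCode.computable_components hc
  refine (computablePred_lt h2 h1).of_eq fun x => ?_
  rw [← h, GaussCode.val_re, div_pos_iff_of_pos_right (by positivity), sub_pos, Nat.cast_lt]

theorem re_lt {f g : α → ℂ} (hf : GaussComputable f) (hg : GaussComputable g) :
    ComputablePred fun x => (f x).re < (g x).re :=
  (hg.sub hf).re_pos.of_eq fun x => by rw [Complex.sub_re, sub_pos]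

theorem re_le {f g : α → ℂ} (hf : GaussComputable f) (hg : GaussComputable g) :
    ComputablePred fun x => (f x).re ≤ (g x).re :=
  (re_lt hg hf).not.of_eq fun _ => not_lt

theorem eq {f g : α → ℂ} (hf : GaussComputable f) (hg : GaussComputable g) :
    ComputablePred fun x => f x = g x :=
  (hf.sub hg).normSq.re_pos.not.of_eq fun x => by
    rw [Complex.ofReal_re, Complex.normSq_pos, not_not, sub_eq_zero]

end GaussComputable

end Computability

/-! ### Approximating algebraic numbers from their codes. -/

section AlgebraicCodes

theorem aeval_polyOfList (w : ℂ) (l : List (ℕ × ℕ)) :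
    Polynomial.aeval w (polyOfList l) =
      ∑ i ∈ Finset.range l.length,
        (((l.getD i (0, 0)).1 : ℂ) - ((l.getD i (0, 0)).2 : ℂ)) * w ^ i := by
  induction l with
  | nil => simp [polyOfList]
  | cons a l ih =>
    rw [List.length_cons, Finset.sum_range_succ']
    simp only [polyOfList, map_add, map_mul, Polynomial.aeval_X, ih, List.getD_cons_succ,
      List.getD_cons_zero, pow_zero, mul_one, Finset.mul_sum, pow_succ]
    rw [add_comm]
    congr 1
    · exact Finset.sum_congr rfl fun i _ => by ring
    · simp

theorem natDegree_polyOfList_le (l : List (ℕ × ℕ)) : (polyOfList l).natDegree ≤ l.length := by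
  induction l with
  | nil => simp [polyOfList]
  | cons a l ih =>
    refine (Polynomial.natDegree_add_le _ _).trans (max_le ?_ ?_)
    · rw [Polynomial.natDegree_C]
      exact Nat.zero_le _
    · refine Polynomial.natDegree_mul_le.trans ?_
      rw [List.length_cons, add_comm]
      exact Nat.add_le_add ih Polynomial.natDegree_X_le

theorem pow_card_le_norm_prod {w : ℂ} {η : ℝ} (hη : 0 ≤ η) (s : Multiset ℂ)
    (h : ∀ z ∈ s, η ≤ ‖w - z‖) : η ^ s.card ≤ ‖(s.map (w - ·)).prod‖ := by
  induction s using Multiset.induction with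
  | empty => simp
  | cons a s ih =>
    rw [Multiset.card_cons, Multiset.map_cons, Multiset.prod_cons, norm_mul, pow_succ, mul_comm]
    exact mul_le_mul (h a (Multiset.mem_cons_self a s))
      (ih fun z hz => h z (Multiset.mem_cons_of_mem hz)) (by positivity) (norm_nonneg _)

/-- Where a nonzero integer polynomial is small, there is a root nearby. -/
theorem exists_root_near {p : Polynomial ℤ} (hp : p ≠ 0) {w : ℂ} {η : ℝ} (hη : 0 < η)
    (hη1 : η ≤ 1) {L : ℕ} (hL : p.natDegree ≤ L) (h : ‖Polynomial.aeval w p‖ < η ^ L) :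
    ∃ z : ℂ, Polynomial.aeval z p = 0 ∧ ‖w - z‖ < η := by
  by_contra! hcon
  set q : Polynomial ℂ := p.map (Int.castRingHom ℂ) with hq
  have hinj : Function.Injective (Int.castRingHom ℂ) := Int.cast_injective
  have heval : ∀ u, Polynomial.aeval u p = q.eval u := fun u => by
    rw [hq, Polynomial.eval_map, Polynomial.aeval_def]; rfl
  have hsplit : q.Splits := IsAlgClosed.splits q
  have hroots := pow_card_le_norm_prod hη.le (w := w) q.roots fun z hz => by
    refine hcon z ?_
    rw [heval]
    exact Polynomial.isRoot_of_mem_roots hz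
  have hcard : q.roots.card ≤ L := by
    refine (Polynomial.card_roots' q).trans ?_
    rwa [hq, Polynomial.natDegree_map_eq_of_injective hinj]
  -- A nonzero integer has modulus at least `1`. If all roots were at distance at least `η ≤ 1` from
  -- `w`, the factorisation over `ℂ` would give `|p(w)| ≥ η ^ L`.
  have hlead : 1 ≤ ‖q.leadingCoeff‖ := by
    rw [hq, Polynomial.leadingCoeff_map_of_injective hinj]
    simp only [eq_intCast, Complex.norm_intCast]
    exact_mod_cast Int.one_le_abs (Polynomial.leadingCoeff_ne_zero.mpr hp)
  rw [heval, hsplit.eval_eq_prod_roots, norm_mul] at h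
  have h1 : η ^ L ≤ η ^ q.roots.card := pow_le_pow_of_le_one hη.le hη1 hcard
  have h2 : 1 * η ^ q.roots.card ≤ ‖q.leadingCoeff‖ * ‖(q.roots.map (w - ·)).prod‖ :=
    mul_le_mul hlead hroots (by positivity) (norm_nonneg _)
  linarith

theorem exists_gaussCode_near (z : ℂ) {ε : ℝ} (hε : 0 < ε) : ∃ c : GaussCode, ‖c.val - z‖ < ε := by
  obtain ⟨p, hp⟩ := exists_rat_near z.re (half_pos hε)
  obtain ⟨q, hq⟩ := exists_rat_near z.im (half_pos hε)
  obtain ⟨c, hc⟩ := GaussCode.exists_val_eq p q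
  refine ⟨c, ?_⟩
  rw [hc]
  refine (Complex.norm_le_abs_re_add_abs_im _).trans_lt ?_
  simp only [Complex.sub_re, Complex.add_re, Complex.ratCast_re, Complex.mul_re,
    Complex.I_re, Complex.ratCast_im, Complex.I_im, Complex.sub_im, Complex.add_im,
    Complex.mul_im]
  simp only [abs_sub_comm] at *
  simp only [mul_zero, mul_one, sub_zero, add_zero, zero_add]
  linarith

variable {α : Type*} [Primcodable α]

theorem gaussComputable_ratCode {f : α → RatCode} (hf : Computable f) :
    GaussComputable fun x => (((f x).val : ℚ) : ℂ) := by
  refine ⟨fun x => (((f x).1, (f x).2.1), (0, 0), (f x).2.2),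
    .pair (.pair (.comp .fst hf) (.comp .fst (.comp .snd hf)))
      (.pair (.const (0, 0)) (.comp .snd (.comp .snd hf))), fun x => ?_⟩
  simp [GaussCode.val, RatCode.val]

theorem gaussComputable_val {f : α → GaussCode} (hf : Computable f) :
    GaussComputable fun x => (f x).val := ⟨f, hf, fun _ => rfl⟩

theorem gaussComputable_one_div {f : α → ℕ} (hf : Computable f) :
    GaussComputable fun x => ((1 / ((f x : ℝ) + 1) : ℝ) : ℂ) :=
  ⟨fun x => ((1, 0), (0, 0), f x), .pair (.const (1, 0)) (.pair (.const (0, 0)) hf),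
    fun x => by simp [GaussCode.val]⟩

theorem gaussComputable_aeval {f : α → List (ℕ × ℕ)} (hf : Computable f) {w : α → ℂ}
    (hw : GaussComputable w) :
    GaussComputable fun x => Polynomial.aeval (w x) (polyOfList (f x)) := by
  have hc : Computable fun x : α × ℕ => (f x.1).getD x.2 (0, 0) :=
    (Primrec.list_getD (0, 0)).to_comp.comp (hf.comp .fst) .snd
  have hterm : GaussComputable fun x : α × ℕ =>
      ((((f x.1).getD x.2 (0, 0)).1 : ℂ) - (((f x.1).getD x.2 (0, 0)).2 : ℂ)) * w x.1 ^ x.2 :=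
    ((GaussComputable.natCast (.comp .fst hc)).sub (.natCast (.comp .snd hc))).mul
      ((hw.comp .fst).pow .snd)
  refine (GaussComputable.sum (f := fun x i =>
    ((((f x).getD i (0, 0)).1 : ℂ) - (((f x).getD i (0, 0)).2 : ℂ)) * w x ^ i) hterm
    (Computable.list_length.comp hf)).of_eq fun x => (aeval_polyOfList _ _).symm

/-- Algebraic numbers given by computable codes have computable Gaussian rational
approximations. -/
theorem exists_gaussComputable_approx {f : α → AlgCode} (hf : Computable f) {z : α → ℂ}
    (hz : ∀ x, (f x).Represents (z x)) :
    ∃ g : α → ℕ → ℂ, GaussComputable (fun x : α × ℕ => g x.1 x.2) ∧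
      ∀ x k, ‖z x - g x k‖ < 1 / ((k : ℝ) + 1) := by
  -- A decidable certificate that `w` approximates `z`. With `η = 1 / (N + 1)` and `N ≥ k`, the
  -- value at `w` is so small that a root lies within `η` of `w`, and `w` is so deep inside the disc
  -- that this root is in the disc too, hence equal to `z`. Norms are squared to stay among Gaussian
  -- rationals; the last clause restores the sign lost by squaring.
  let p : α × ℕ → GaussCode × ℕ → Prop := fun x y =>
    x.2 < y.2 + 1 ∧
    Complex.normSq (Polynomial.aeval y.1.val (f x.1).poly) <
      ((1 / ((y.2 : ℝ) + 1)) ^ (f x.1).1.length) ^ 2 ∧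
    Complex.normSq (y.1.val - (f x.1).centre) ≤ ((f x.1).radius - 1 / ((y.2 : ℝ) + 1)) ^ 2 ∧
    1 / ((y.2 : ℝ) + 1) ≤ (f x.1).radius
  have hp : ComputablePred fun x : (α × ℕ) × GaussCode × ℕ => p x.1 x.2 := by
    have hk : Computable fun x : (α × ℕ) × GaussCode × ℕ => x.1.2 := .comp .snd .fst
    have hN : Computable fun x : (α × ℕ) × GaussCode × ℕ => x.2.2 := .comp .snd .snd
    have hF : Computable fun x : (α × ℕ) × GaussCode × ℕ => f x.1.1 :=
      hf.comp (.comp .fst .fst)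
    have hw : GaussComputable fun x : (α × ℕ) × GaussCode × ℕ => x.2.1.val :=
      gaussComputable_val (.comp .fst .snd)
    have hη := gaussComputable_one_div hN
    have hlist : Computable fun x : (α × ℕ) × GaussCode × ℕ => (f x.1.1).1 := .comp .fst hF
    have hradius : GaussComputable fun x : (α × ℕ) × GaussCode × ℕ =>
        (((f x.1.1).radius : ℝ) : ℂ) :=
      (gaussComputable_ratCode (.comp .snd (.comp .snd hF))).of_eq fun x => by
        simp [AlgCode.radius]
    have hcentre : GaussComputable fun x : (α × ℕ) × GaussCode × ℕ => (f x.1.1).centre :=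
      ((gaussComputable_ratCode (.comp .fst (.comp .fst (.comp .snd hF)))).add
        ((gaussComputable_ratCode (.comp .snd (.comp .fst (.comp .snd hF)))).mul
          ((GaussComputable.const 0 1).of_eq fun _ => by simp : GaussComputable
            fun _ : (α × ℕ) × GaussCode × ℕ => Complex.I))).of_eq fun x => by
        apply Complex.ext <;> simp [AlgCode.centre]
    refine computablePred_and (computablePred_lt hk (computable_nat_add hN (.const 1)))
      (computablePred_and ?_ (computablePred_and ?_ ?_))
    · exact ((gaussComputable_aeval hlist hw).normSq.re_lt
        ((hη.pow (Computable.list_length.comp hlist)).pow (.const 2))).of_eq fun x => by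
          rw [← Complex.ofReal_pow, ← Complex.ofReal_pow, Complex.ofReal_re, Complex.ofReal_re]
          rfl
    · exact ((hw.sub hcentre).normSq.re_le ((hradius.sub hη).pow (.const 2))).of_eq fun x => by
        rw [← Complex.ofReal_sub, ← Complex.ofReal_pow, Complex.ofReal_re, Complex.ofReal_re]
    · exact (hη.re_le hradius).of_eq fun x => by rw [Complex.ofReal_re, Complex.ofReal_re]
  have hex : ∀ x, ∃ y, p x y := by
    rintro ⟨a, k⟩
    obtain ⟨-, hroot, hdisc, -⟩ := hz a
    obtain ⟨N, hN⟩ := exists_nat_one_div_lt (sub_pos.mpr hdisc)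
    -- `M` serves the required precision `k` and leaves `z` farther than `1 / (M + 1)` from the edge
    -- of the disc; by continuity every point close to `z` then passes the test.
    set M := max N k with hM
    have hM1 : 1 / ((M : ℝ) + 1) < (f a).radius - ‖z a - (f a).centre‖ :=
      (one_div_le_one_div_of_le (by positivity)
        (by exact_mod_cast Nat.succ_le_succ (le_max_left N k))).trans_lt hN
    have hpos : (0 : ℝ) < (1 / ((M : ℝ) + 1)) ^ (f a).1.length := by positivity
    have hcont : Continuous fun w : ℂ => Polynomial.aeval w (f a).poly :=
      (f a).poly.continuous_aeval
    have h1 : ∀ᶠ w in 𝓝 (z a), ‖Polynomial.aeval w (f a).poly‖ <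
        (1 / ((M : ℝ) + 1)) ^ (f a).1.length :=
      (hcont.norm.tendsto (z a)).eventually_lt_const (by rw [hroot, norm_zero]; exact hpos)
    have h2 : ∀ᶠ w in 𝓝 (z a), ‖w - (f a).centre‖ < (f a).radius - 1 / ((M : ℝ) + 1) :=
      ((continuous_id.sub continuous_const).norm.tendsto (z a)).eventually_lt_const
        (by change ‖z a - (f a).centre‖ < _; linarith)
    obtain ⟨ε, hε, hball⟩ := Metric.eventually_nhds_iff.mp (h1.and h2)
    obtain ⟨c, hc⟩ := exists_gaussCode_near (z a) hε
    obtain ⟨h3, h4⟩ := hball (y := c.val) (by rwa [dist_eq_norm])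
    refine ⟨(c, M), Nat.lt_succ_of_le (le_max_right _ _), ?_, ?_, ?_⟩
    · rw [Complex.normSq_eq_norm_sq]
      exact pow_lt_pow_left₀ h3 (norm_nonneg _) two_ne_zero
    · rw [Complex.normSq_eq_norm_sq]
      exact pow_le_pow_left₀ (norm_nonneg _) h4.le 2
    · have := norm_nonneg (c.val - (f a).centre)
      change 1 / ((M : ℝ) + 1) ≤ (f a).radius
      linarith
  obtain ⟨g, hg, hgp⟩ := exists_computable_choice hp hex
  refine ⟨fun a k => (g (a, k)).1.val, gaussComputable_val (.comp .fst hg), fun a k => ?_⟩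
  obtain ⟨h1, h2, h3, h4⟩ := hgp (a, k)
  obtain ⟨hne, -, -, huniq⟩ := hz a
  set w := (g (a, k)).1.val
  set M := (g (a, k)).2
  have hη : (0 : ℝ) < 1 / ((M : ℝ) + 1) := by positivity
  have hη1 : 1 / ((M : ℝ) + 1) ≤ 1 := by
    rw [div_le_one (by positivity)]; linarith [(Nat.cast_nonneg M : (0 : ℝ) ≤ M)]
  have hηk : 1 / ((M : ℝ) + 1) ≤ 1 / ((k : ℝ) + 1) :=
    one_div_le_one_div_of_le (by positivity)
      (by exact_mod_cast Nat.succ_le_succ (Nat.le_of_lt_succ h1))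
  rw [Complex.normSq_eq_norm_sq] at h2 h3
  obtain ⟨u, hu, hwu⟩ := exists_root_near hne hη hη1 (natDegree_polyOfList_le (f a).1)
    (lt_of_pow_lt_pow_left₀ 2 (by positivity) h2)
  have h5 : ‖w - (f a).centre‖ ≤ (f a).radius - 1 / ((M : ℝ) + 1) :=
    le_of_sq_le_sq h3 (sub_nonneg.mpr h4)
  have h6 : ‖u - (f a).centre‖ < (f a).radius := by
    have := norm_add_le (u - w) (w - (f a).centre)
    rw [sub_add_sub_cancel, norm_sub_rev u w] at this
    linarith
  rw [← huniq u hu h6, norm_sub_rev]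
  exact hwu.trans_le hηk

end AlgebraicCodes

/-! ### Gaussian rationals as coded algebraic numbers. -/

/-- The code of a Gaussian rational as an algebraic number. -/
def GaussCode.toAlgCode (x : GaussCode) : AlgCode :=
  -- With `D = e + 1` the coefficients are those of `D² (X - z)(X - z̄)`; the disc has centre `z`
  -- and radius `1 / D`.
  ([(x.1.1 * x.1.1 + x.1.2 * x.1.2 + (x.2.1.1 * x.2.1.1 + x.2.1.2 * x.2.1.2),
      2 * (x.1.1 * x.1.2 + x.2.1.1 * x.2.1.2)),
    (2 * (x.1.2 * (x.2.2 + 1)), 2 * (x.1.1 * (x.2.2 + 1))),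
    ((x.2.2 + 1) * (x.2.2 + 1), 0)],
    ((x.1.1, x.1.2, x.2.2), (x.2.1.1, x.2.1.2, x.2.2)), (1, 0, x.2.2))

theorem GaussCode.computable_toAlgCode : Computable GaussCode.toAlgCode := by
  have f1 : Computable fun x : GaussCode => x.1.1 := .comp .fst .fst
  have f2 : Computable fun x : GaussCode => x.1.2 := .comp .snd .fst
  have f3 : Computable fun x : GaussCode => x.2.1.1 := .comp .fst (.comp .fst .snd)
  have f4 : Computable fun x : GaussCode => x.2.1.2 := .comp .snd (.comp .fst .snd)
  have f5 : Computable fun x : GaussCode => x.2.2 := .comp .snd .snd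
  have f6 : Computable fun x : GaussCode => x.2.2 + 1 := computable_nat_add f5 (.const 1)
  have two : Computable fun _ : GaussCode => 2 := .const 2
  refine Computable.pair (Computable.list_cons.comp (.pair ?_ ?_) (Computable.list_cons.comp
    (.pair ?_ ?_) (Computable.list_cons.comp (.pair ?_ (.const 0)) (.const []))))
    (.pair (.pair (.pair f1 (.pair f2 f5)) (.pair f3 (.pair f4 f5)))
      (.pair (.const 1) (.pair (.const 0) f5)))
  · exact computable_nat_add (computable_nat_add (computable_nat_mul f1 f1)
      (computable_nat_mul f2 f2)) (computable_nat_add (computable_nat_mul f3 f3)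
        (computable_nat_mul f4 f4))
  · exact computable_nat_mul two (computable_nat_add (computable_nat_mul f1 f2)
      (computable_nat_mul f3 f4))
  · exact computable_nat_mul two (computable_nat_mul f2 f6)
  · exact computable_nat_mul two (computable_nat_mul f1 f6)
  · exact computable_nat_mul f6 f6

/-- The only other candidate root is `z̄`, at distance `2|c - d| / (e + 1)` from `z`. This is either
`0`, and then `z̄ = z`, or at least twice the radius. -/
theorem GaussCode.toAlgCode_represents (x : GaussCode) : x.toAlgCode.Represents x.val := by
  have hD := den_ne_zero x.2.2
  have hD' : (0 : ℝ) < (x.2.2 : ℝ) + 1 := by positivity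
  have heval : ∀ w : ℂ, Polynomial.aeval w x.toAlgCode.poly =
      ((x.2.2 : ℂ) + 1) ^ 2 * ((w - x.val) * (w - x.conj.val)) := fun w => by
    simp only [AlgCode.poly, toAlgCode, aeval_polyOfList, List.length_cons, List.length_nil,
      Finset.sum_range_succ, Finset.sum_range_zero, val, conj]
    simp only [List.getD_cons_succ, List.getD_cons_zero]
    push_cast
    field_simp
    linear_combination (((x.2.1.1 : ℂ) - x.2.1.2) ^ 2) * Complex.I_sq
  have hcentre : x.toAlgCode.centre = x.val := by
    apply Complex.ext
    · rw [val_re]; simp [AlgCode.centre, toAlgCode, RatCode.val]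
    · rw [val_im]; simp [AlgCode.centre, toAlgCode, RatCode.val]
  have hradius : x.toAlgCode.radius = 1 / ((x.2.2 : ℝ) + 1) := by
    simp [AlgCode.radius, toAlgCode, RatCode.val]
  refine ⟨fun h => ?_, by rw [heval]; ring, ?_, fun w hw hlt => ?_⟩
  · have h2 := heval (x.val + 1)
    rw [h, map_zero, eq_comm, mul_eq_zero, mul_eq_zero] at h2
    rcases h2 with h2 | h2 | h2
    · exact pow_ne_zero 2 hD h2
    · simp at h2
    · have h3 := congrArg Complex.re h2
      rw [val_conj] at h3
      simp at h3
  · rw [hcentre, hradius, sub_self, norm_zero]; positivity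
  · rw [heval, mul_eq_zero, mul_eq_zero, sub_eq_zero, sub_eq_zero] at hw
    rcases hw with hw | hw | hw
    · exact absurd hw (pow_ne_zero 2 hD)
    · exact hw
    · rw [hcentre, hradius, hw] at hlt
      have h1 := (Complex.abs_im_le_norm _).trans_lt hlt
      rw [val_conj, Complex.sub_im, Complex.conj_im, val_im, ← neg_add', abs_neg, ← add_div,
        abs_div, abs_of_pos hD', div_lt_div_iff_of_pos_right hD'] at h1
      have h2 : |((x.2.1.1 : ℤ) - x.2.1.2) + ((x.2.1.1 : ℤ) - x.2.1.2)| < 1 := by exact_mod_cast h1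
      have h3 : (x.2.1.1 : ℤ) = x.2.1.2 := by
        rw [Int.abs_lt_one_iff] at h2; omega
      have h4 : x.2.1.1 = x.2.1.2 := by exact_mod_cast h3
      rw [hw]
      simp [val, conj, h4]

/-! ### Spectral tails and uniform integrability. -/

namespace QState

/-- The sorted and the unsorted eigenvalues differ by a reindexing. The step functions need the
sorted ones; the spectral theorem is stated for the others. -/
theorem sum_eig (ρ : QState) (n : ℕ) (g : ℝ → ℝ) :
    ∑ i, g (ρ.eig n i) = ∑ i, g ((ρ.posSemidef n).isHermitian.eigenvalues i) := by
  trans ∑ j, g ((ρ.posSemidef n).isHermitian.eigenvalues₀ j)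
  · exact Equiv.sum_comp (finCongr (Fintype.card_fin (2 ^ n)).symm)
      fun j => g ((ρ.posSemidef n).isHermitian.eigenvalues₀ j)
  · exact (Equiv.sum_comp
      (Fintype.equivOfCardEq (Fintype.card_fin (Fintype.card (Fin (2 ^ n))))).symm
      fun j => g ((ρ.posSemidef n).isHermitian.eigenvalues₀ j)).symm

theorem eigenvalues_nonneg (ρ : QState) (n : ℕ) (i : Fin (2 ^ n)) :
    0 ≤ (ρ.posSemidef n).isHermitian.eigenvalues i := (ρ.posSemidef n).eigenvalues_nonneg i

theorem sum_eigenvalues (ρ : QState) (n : ℕ) :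
    ∑ i, (ρ.posSemidef n).isHermitian.eigenvalues i = 1 := by
  have h := (ρ.posSemidef n).isHermitian.trace_eq_sum_eigenvalues
  rw [ρ.trace_eq_one] at h
  apply Complex.ofReal_injective
  rw [Complex.ofReal_sum, Complex.ofReal_one]
  exact h.symm

theorem eig_nonneg (ρ : QState) (n : ℕ) (i : Fin (2 ^ n)) : 0 ≤ ρ.eig n i := by
  have h := ρ.eigenvalues_nonneg n
  unfold eig
  have := h ((Fintype.equivOfCardEq (Fintype.card_fin _)) (Fin.cast (Fintype.card_fin _).symm i))
  unfold Matrix.IsHermitian.eigenvalues at this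
  simpa using this

/-- The total weight of the eigenvalues of the `n`-th density matrix that exceed `2⁻ⁿ t`. -/
noncomputable def tail (ρ : QState) (n : ℕ) (t : ℝ) : ℝ :=
  ∑ i, if t < 2 ^ n * ρ.eig n i then ρ.eig n i else 0

theorem tail_eq (ρ : QState) (n : ℕ) (t : ℝ) :
    ρ.tail n t = ∑ i with t < 2 ^ n * (ρ.posSemidef n).isHermitian.eigenvalues i,
      (ρ.posSemidef n).isHermitian.eigenvalues i := by
  rw [Finset.sum_filter]
  exact ρ.sum_eig n fun a => if t < 2 ^ n * a then a else 0

/-- The tails of the spectra are small, uniformly in the number of qubits. -/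
def HasSmallTails (ρ : QState) : Prop := ∀ δ : ℝ, 0 < δ → ∃ t : ℝ, 0 < t ∧ ∀ n, ρ.tail n t < δ

/-- Markov's inequality for eigenvalues that are nonnegative with sum `1`. -/
theorem card_lt_eigenvalues_le (ρ : QState) (n : ℕ) {t : ℝ} (ht : 0 < t) :
    (Finset.card {i | t < 2 ^ n * (ρ.posSemidef n).isHermitian.eigenvalues i} : ℝ) / 2 ^ n
      ≤ 1 / t := by
  rw [div_le_div_iff₀ (by positivity) ht, one_mul, ← nsmul_eq_mul]
  refine (Finset.card_nsmul_le_sum _ (fun i =>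
    2 ^ n * (ρ.posSemidef n).isHermitian.eigenvalues i) t
      fun i hi => (Finset.mem_filter.mp hi).2.le).trans ?_
  rw [← Finset.mul_sum]
  refine mul_le_of_le_one_right (by positivity) ?_
  rw [← ρ.sum_eigenvalues n]
  exact Finset.sum_le_univ_sum_of_nonneg (ρ.eigenvalues_nonneg n)

theorem card_lt_eig_le (ρ : QState) (n : ℕ) {t : ℝ} (ht : 0 < t) :
    (Finset.card {i | t < 2 ^ n * ρ.eig n i} : ℝ) / 2 ^ n ≤ 1 / t := by
  have h := ρ.sum_eig n fun a => if t < 2 ^ n * a then 1 else 0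
  rw [← Finset.sum_filter, ← Finset.sum_filter, Finset.sum_const, Finset.sum_const, nsmul_one,
    nsmul_one] at h
  rw [h]
  exact ρ.card_lt_eigenvalues_le n ht

/-- `HasSmallTails` includes `n = 0`, which `family` leaves out. There the only eigenvalue is `1`,
so heights `t ≥ 1` cut nothing off. -/
theorem tail_zero_eq_zero (ρ : QState) {t : ℝ} (ht : 1 ≤ t) : ρ.tail 0 t = 0 := by
  rw [tail_eq]
  refine Finset.sum_eq_zero fun i hi => absurd (Finset.mem_filter.mp hi).2 (not_lt.mpr ?_)
  rw [pow_zero, one_mul]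
  refine le_trans ?_ ht
  rw [← ρ.sum_eigenvalues 0]
  exact Finset.single_le_sum (fun i _ => ρ.eigenvalues_nonneg 0 i) (Finset.mem_univ i)

/-- The `i`-th of the `2^n` half-open intervals of length `2⁻ⁿ`. -/
def cell (n : ℕ) (i : Fin (2 ^ n)) : Set ℝ := Set.Ico ((i : ℝ) / 2 ^ n) (((i : ℝ) + 1) / 2 ^ n)

theorem measurableSet_cell (n : ℕ) (i : Fin (2 ^ n)) : MeasurableSet (cell n i) :=
  measurableSet_Ico

theorem volume_cell (n : ℕ) (i : Fin (2 ^ n)) :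
    volume (cell n i) = ENNReal.ofReal (1 / 2 ^ n) := by
  rw [cell, Real.volume_Ico]
  congr 1
  ring

theorem cell_subset (n : ℕ) (i : Fin (2 ^ n)) : cell n i ⊆ Set.Ico 0 1 := by
  refine Set.Ico_subset_Ico (by positivity) ?_
  rw [div_le_one (by positivity)]
  exact_mod_cast i.isLt

theorem pairwise_disjoint_cell (n : ℕ) : Pairwise fun i j => Disjoint (cell n i) (cell n j) := by
  have key : ∀ i j : Fin (2 ^ n), i < j → Disjoint (cell n i) (cell n j) := fun i j hij => by
    rw [cell, cell, Set.Ico_disjoint_Ico]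
    refine (min_le_left _ _).trans (le_trans ?_ (le_max_right _ _))
    gcongr
    exact_mod_cast hij
  intro i j hij
  rcases lt_or_gt_of_ne hij with h | h
  · exact key i j h
  · exact (key j i h).symm

theorem integrable_cell (ρ : QState) (n : ℕ) (i : Fin (2 ^ n)) (S : Set ℝ) :
    Integrable ((cell n i).indicator fun _ => 2 ^ n * ρ.eig n i) (volume.restrict S) := by
  rw [integrable_indicator_iff (measurableSet_cell n i)]
  refine integrableOn_const (ne_of_lt ?_)
  refine (Measure.restrict_apply_le _ _).trans_lt ?_
  rw [volume_cell]
  exact ENNReal.ofReal_lt_top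

theorem integrableOn_stepFun (ρ : QState) (n : ℕ) (S : Set ℝ) :
    IntegrableOn (ρ.stepFun n) S volume :=
  integrable_finsetSum _ fun i _ => ρ.integrable_cell n i S

theorem setIntegral_stepFun (ρ : QState) (n : ℕ) (S : Set ℝ) :
    ∫ x in S, ρ.stepFun n x =
      ∑ i, (volume.restrict S).real (cell n i) * (2 ^ n * ρ.eig n i) := by
  have h : (fun x => ρ.stepFun n x) = fun x =>
      ∑ i, (cell n i).indicator (fun _ => 2 ^ n * ρ.eig n i) x := rfl
  rw [h, integral_finsetSum _ fun i _ => ρ.integrable_cell n i S]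
  refine Finset.sum_congr rfl fun i _ => ?_
  rw [integral_indicator (measurableSet_cell n i), setIntegral_const, smul_eq_mul]

/-- Cells of height above `t` contribute at most their whole integral, which is the eigenvalue; on
the others the integrand is at most `t`, and together they meet `S` in measure at most `ε`. -/
theorem setIntegral_stepFun_le (ρ : QState) (n : ℕ) {t ε : ℝ} (ht : 0 ≤ t) (hε : 0 ≤ ε)
    {S : Set ℝ} (hS : volume S ≤ ENNReal.ofReal ε) :
    |∫ x in S, ρ.stepFun n x| ≤ ρ.tail n t + t * ε := by
  have hfin : volume S ≠ ⊤ := ne_top_of_le_ne_top ENNReal.ofReal_ne_top hS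
  have : IsFiniteMeasure (volume.restrict S) := ⟨by
    rw [Measure.restrict_apply_univ]; exact hfin.lt_top⟩
  have hcell : ∀ i, (volume.restrict S).real (cell n i) ≤ 1 / 2 ^ n := fun i => by
    refine ENNReal.toReal_le_of_le_ofReal (by positivity) ?_
    rw [← volume_cell n i]
    exact Measure.restrict_apply_le _ _
  have hsum : ∑ i, (volume.restrict S).real (cell n i) ≤ ε := by
    rw [← measureReal_biUnion_finset (fun i _ j _ hij => pairwise_disjoint_cell n hij)
      fun i _ => measurableSet_cell n i]
    refine ENNReal.toReal_le_of_le_ofReal hε ((measure_mono (Set.subset_univ _)).trans ?_)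
    rwa [Measure.restrict_apply_univ]
  rw [setIntegral_stepFun, abs_of_nonneg (Finset.sum_nonneg fun i _ =>
    mul_nonneg measureReal_nonneg (mul_nonneg (by positivity) (ρ.eig_nonneg n i)))]
  refine le_trans ?_ (add_le_add_right (mul_le_mul_of_nonneg_left hsum ht) _)
  rw [tail, Finset.mul_sum, ← Finset.sum_add_distrib]
  refine Finset.sum_le_sum fun i _ => ?_
  have h0 : 0 ≤ (volume.restrict S).real (cell n i) := measureReal_nonneg
  have he := ρ.eig_nonneg n i
  split_ifs with hi
  · have h1 := mul_le_mul_of_nonneg_right (hcell i)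
      (mul_nonneg (by positivity : (0 : ℝ) ≤ 2 ^ n) he)
    have h2 : 1 / 2 ^ n * (2 ^ n * ρ.eig n i) = ρ.eig n i := by field_simp
    have h3 := mul_nonneg ht h0
    linarith
  · have := mul_le_mul_of_nonneg_left (not_lt.mp hi) h0
    linarith

/-- `S` is the union of the cells of height above `t`, whose measure Markov's inequality bounds. -/
theorem exists_tail_le_setIntegral (ρ : QState) (n : ℕ) {t : ℝ} (ht : 0 < t) :
    ∃ S ⊆ Set.Ico (0 : ℝ) 1, MeasurableSet S ∧ volume S ≤ ENNReal.ofReal (1 / t) ∧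
      ρ.tail n t ≤ ∫ x in S, ρ.stepFun n x := by
  set s : Finset (Fin (2 ^ n)) := {i | t < 2 ^ n * ρ.eig n i} with hs
  refine ⟨⋃ i ∈ s, cell n i, Set.iUnion₂_subset fun i _ => cell_subset n i,
    s.measurableSet_biUnion fun i _ => measurableSet_cell n i, ?_, ?_⟩
  · refine (measure_biUnion_finset_le s _).trans ?_
    simp only [volume_cell, Finset.sum_const]
    rw [← ENNReal.ofReal_nsmul]
    refine ENNReal.ofReal_le_ofReal (le_trans (le_of_eq ?_) (ρ.card_lt_eig_le n ht))
    rw [nsmul_eq_mul, mul_one_div]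
  · rw [setIntegral_stepFun, tail]
    refine Finset.sum_le_sum fun i _ => ?_
    have he := ρ.eig_nonneg n i
    split_ifs with hi
    · have hmem : i ∈ s := Finset.mem_filter.mpr ⟨Finset.mem_univ i, hi⟩
      rw [measureReal_restrict_apply (measurableSet_cell n i),
        Set.inter_eq_left.mpr (Set.subset_iUnion₂ (s := fun i (_ : i ∈ s) => cell n i) i hmem),
        Measure.real, volume_cell, ENNReal.toReal_ofReal (by positivity)]
      apply le_of_eq
      field_simp
    · exact mul_nonneg measureReal_nonneg (mul_nonneg (by positivity) he)

theorem uniformlyIntegrable_iff_hasSmallTails (ρ : QState) :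
    UniformlyIntegrableUnit ρ.family ↔ ρ.HasSmallTails := by
  constructor
  · rintro ⟨-, h⟩ δ hδ
    obtain ⟨ε, hε, h⟩ := h δ hδ
    -- The height `1 / ε` makes the set of high cells have measure at most `ε`; the `1` disposes of
    -- `n = 0`.
    refine ⟨max 1 (1 / ε), by positivity, fun n => ?_⟩
    rcases n with _ | n
    · rw [ρ.tail_zero_eq_zero (le_max_left _ _)]
      exact hδ
    obtain ⟨S, hS, hSm, hvol, hle⟩ := ρ.exists_tail_le_setIntegral (n + 1)
      (t := max 1 (1 / ε)) (by positivity)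
    have h1 := h S hS hSm (hvol.trans (ENNReal.ofReal_le_ofReal (by
      rw [div_le_comm₀ (by positivity) hε]
      exact le_max_right _ _)))
    have h2 := (le_iSup (fun i => ENNReal.ofReal |∫ x in S, ρ.family i x|) n).trans_lt h1
    exact (hle.trans (le_abs_self _)).trans_lt (ENNReal.ofReal_lt_ofReal_iff hδ |>.mp h2)
  · refine fun h => ⟨fun i => ρ.integrableOn_stepFun _ _, fun δ hδ => ?_⟩
    obtain ⟨t, ht, h⟩ := h (δ / 4) (by positivity)
    refine ⟨δ / (4 * t), by positivity, fun S _ _ hvol => ?_⟩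
    -- A supremum of terms below `δ` may equal `δ`, so each term is bounded by `δ / 2`: half of it
    -- from the tail, half from `t * ε`.
    refine lt_of_le_of_lt (b := ENNReal.ofReal (δ / 2)) (iSup_le fun i => ?_)
      ((ENNReal.ofReal_lt_ofReal_iff hδ).mpr (by linarith))
    refine ENNReal.ofReal_le_ofReal ?_
    refine (ρ.setIntegral_stepFun_le (i + 1) ht.le (by positivity) hvol).trans ?_
    have h1 : t * (δ / (4 * t)) = δ / 4 := by field_simp
    linarith [h (i + 1)]

end QState

/-! ### Small tails imply randomness. -/

/-- From `Q = Q Q*`, the entry `Q i i` is the sum of the `|Q i k|²`, hence at least its own square.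
-/
theorem isStarProjection_diag {N : Type*} [Fintype N] [DecidableEq N] {Q : Matrix N N ℂ}
    (hQ : IsStarProjection Q) (i : N) : 0 ≤ (Q i i).re ∧ (Q i i).re ≤ 1 := by
  have h1 : Q i i = ∑ k, (Complex.normSq (Q i k) : ℂ) := by
    conv_lhs => rw [← hQ.isIdempotentElem.eq, Matrix.mul_apply]
    refine Finset.sum_congr rfl fun k _ => ?_
    rw [← Complex.mul_conj]
    congr 1
    conv_lhs => rw [← hQ.isSelfAdjoint.star_eq]
    rfl
  have h2 : (Q i i).re = ∑ k, Complex.normSq (Q i k) := by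
    conv_lhs => rw [h1, ← Complex.ofReal_sum, Complex.ofReal_re]
  have h3 : Complex.normSq (Q i i) ≤ (Q i i).re := by
    conv_rhs => rw [h2]
    exact Finset.single_le_sum (f := fun k => Complex.normSq (Q i k))
      (fun k _ => Complex.normSq_nonneg _) (Finset.mem_univ i)
  have h4 : (Q i i).re * (Q i i).re ≤ Complex.normSq (Q i i) := by
    rw [Complex.normSq_apply]
    linarith [mul_self_nonneg (Q i i).im]
  refine ⟨h2 ▸ Finset.sum_nonneg fun k _ => Complex.normSq_nonneg _, ?_⟩
  nlinarith

/-- In an eigenbasis `ρ(G)` is the sum of the `α_i q_i`, where the `q_i` in `[0, 1]` are diagonal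
entries of the conjugated projection and sum to `Tr G`. Use `q_i ≤ 1` for eigenvalues above `2⁻ⁿ t`
and `α_i ≤ 2⁻ⁿ t` for the rest. -/
theorem QState.prob_le (ρ : QState) (G : SpecialProjection) {t : ℝ} (ht : 0 ≤ t) :
    ρ.prob G ≤ ρ.tail G.qubits t + t * G.tau := by
  obtain ⟨n, M, hM, -⟩ := G
  change (ρ.mat n * M).trace.re ≤ ρ.tail n t + t * (M.trace.re / 2 ^ n)
  set hA := (ρ.posSemidef n).isHermitian with hAdef
  set U : QMat n := (hA.eigenvectorUnitary).1 with hU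
  have hUU : U * star U = 1 := Unitary.coe_mul_star_self hA.eigenvectorUnitary
  set Q : QMat n := star U * M * U with hQdef
  have hQ : IsStarProjection Q := by
    refine ⟨?_, ?_⟩
    · have : Q * Q = star U * (M * (U * star U) * M) * U := by
        simp only [hQdef, mul_assoc]
      rw [IsIdempotentElem, this, hUU, mul_one, hM.isIdempotentElem.eq]
    · rw [isSelfAdjoint_iff, hQdef, star_mul, star_mul, star_star,
        hM.isSelfAdjoint.star_eq, mul_assoc]
  have htrQ : Q.trace = M.trace := by
    rw [hQdef, Matrix.trace_mul_comm, ← mul_assoc, hUU, one_mul]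
  have hprob : (ρ.mat n * M).trace.re = ∑ i, hA.eigenvalues i * (Q i i).re := by
    have hsp := hA.spectral_theorem
    rw [Unitary.conjStarAlgAut_apply] at hsp
    have : (ρ.mat n * M).trace =
        (Matrix.diagonal (RCLike.ofReal ∘ hA.eigenvalues) * Q).trace := by
      conv_lhs => rw [hsp]
      rw [mul_assoc, mul_assoc, Matrix.trace_mul_comm, hQdef]
      simp only [mul_assoc]
      rfl
    rw [this, Matrix.trace, Complex.re_sum]
    refine Finset.sum_congr rfl fun i _ => ?_
    rw [Matrix.diag_apply, Matrix.diagonal_mul]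
    exact Complex.re_ofReal_mul _ _
  have htau : t * (M.trace.re / 2 ^ n) = ∑ i, t / 2 ^ n * (Q i i).re := by
    rw [← htrQ, Matrix.trace, Complex.re_sum, ← Finset.mul_sum]
    simp only [Matrix.diag_apply]
    ring
  rw [hprob, htau, ρ.tail_eq, Finset.sum_filter, ← Finset.sum_add_distrib]
  refine Finset.sum_le_sum fun i _ => ?_
  obtain ⟨h0, h1⟩ := isStarProjection_diag hQ i
  have he : 0 ≤ hA.eigenvalues i := ρ.eigenvalues_nonneg n i
  split_ifs with hi
  · have h2 := mul_le_of_le_one_right he h1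
    have h3 : 0 ≤ t / 2 ^ n * (Q i i).re := by positivity
    linarith
  · rw [zero_add]
    refine mul_le_mul_of_nonneg_right ?_ h0
    rw [le_div_iff₀ (by positivity), mul_comm]
    exact not_lt.mp hi

namespace QState

/-- The common source of both randomness notions: one asks for a single such `m`, the other for all
but finitely many. -/
theorem HasSmallTails.eventually_prob_le {ρ : QState} (h : ρ.HasSmallTails)
    {T : ℕ → SpecialProjection} (hT : IsQuantumNullCondition T) {δ : ℝ} (hδ : 0 < δ) :
    ∀ᶠ m in atTop, ρ.prob (T m) ≤ δ := by
  obtain ⟨t, ht, h⟩ := h (δ / 2) (half_pos hδ)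
  have : ∀ᶠ m in atTop, (T m).tau < δ / (2 * t) := hT.eventually_lt_const (by positivity)
  filter_upwards [this] with m hm
  have h1 := ρ.prob_le (T m) ht.le
  have h2 := mul_le_mul_of_nonneg_left hm.le ht.le
  have h3 : t * (δ / (2 * t)) = δ / 2 := by field_simp
  linarith [h (T m).qubits]

theorem HasSmallTails.isStrongQuantumRandom {ρ : QState} (h : ρ.HasSmallTails) :
    ρ.IsStrongQuantumRandom := fun _ hT _ hδ => (h.eventually_prob_le hT hδ).exists

theorem HasSmallTails.isQuantumSchnorrRandom {ρ : QState} (h : ρ.HasSmallTails) :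
    ρ.IsQuantumSchnorrRandom := fun S hS δ hδ => by
  obtain ⟨r, hr, -⟩ := hS.sum_computable
  have hev := h.eventually_prob_le (T := S) hr.summable.tendsto_atTop_zero hδ
  rw [← Nat.cofinite_eq_atTop, eventually_cofinite] at hev
  rw [FailsAt, Set.not_infinite]
  simpa only [not_le] using hev

end QState

/-! ### Gaussian rational projections near spectral projections. -/

/-- The field of Gaussian rationals. -/
def gaussRat : Subfield ℂ where
  carrier := {z | ∃ p q : ℚ, z = (p : ℂ) + (q : ℂ) * Complex.I}
  mul_mem' := by
    rintro _ _ ⟨p, q, rfl⟩ ⟨p', q', rfl⟩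
    refine ⟨p * p' - q * q', p * q' + q * p', ?_⟩
    push_cast
    linear_combination ((q : ℂ) * q') * Complex.I_sq
  one_mem' := ⟨1, 0, by simp⟩
  add_mem' := by
    rintro _ _ ⟨p, q, rfl⟩ ⟨p', q', rfl⟩
    exact ⟨p + p', q + q', by push_cast; ring⟩
  zero_mem' := ⟨0, 0, by simp⟩
  neg_mem' := by
    rintro _ ⟨p, q, rfl⟩
    exact ⟨-p, -q, by push_cast; ring⟩
  inv_mem' := by
    rintro _ ⟨p, q, rfl⟩
    refine ⟨p / (p * p + q * q), -q / (p * p + q * q), ?_⟩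
    have h : Complex.normSq ((p : ℂ) + q * Complex.I) = ((p * p + q * q : ℚ) : ℝ) := by
      simp [Complex.normSq_apply]
    rw [Complex.inv_def, h]
    simp only [map_add, map_mul, Complex.conj_I, map_ratCast]
    push_cast
    ring

theorem star_mem_gaussRat {z : ℂ} (hz : z ∈ gaussRat) : star z ∈ gaussRat := by
  obtain ⟨p, q, rfl⟩ := hz
  exact ⟨p, -q, by simp⟩

theorem GaussCode.val_mem_gaussRat (c : GaussCode) : c.val ∈ gaussRat := by
  refine ⟨((c.1.1 : ℚ) - c.1.2) / (c.2.2 + 1), ((c.2.1.1 : ℚ) - c.2.1.2) / (c.2.2 + 1), ?_⟩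
  simp only [val]
  push_cast
  ring

theorem exists_gaussCode_of_mem {z : ℂ} (hz : z ∈ gaussRat) : ∃ c : GaussCode, c.val = z := by
  obtain ⟨p, q, rfl⟩ := hz
  exact GaussCode.exists_val_eq p q

theorem denseRange_gaussCode_val : DenseRange GaussCode.val := fun z =>
  Metric.mem_closure_range_iff.mpr fun ε hε => by
    obtain ⟨c, hc⟩ := exists_gaussCode_near z hε
    exact ⟨c, by rwa [dist_comm, dist_eq_norm]⟩

section Matrices

open Matrix

variable {N s : Type*} [Fintype N] [Fintype s]

theorem mul_mem_gaussRat {N l s : Type*} [Fintype N] {A : Matrix l N ℂ} {B : Matrix N s ℂ}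
    (hA : ∀ i j, A i j ∈ gaussRat) (hB : ∀ i j, B i j ∈ gaussRat) (i : l) (j : s) :
    (A * B) i j ∈ gaussRat := by
  rw [mul_apply]
  exact sum_mem fun k _ => mul_mem (hA i k) (hB k j)

theorem det_mem_gaussRat [DecidableEq N] {A : Matrix N N ℂ} (hA : ∀ i j, A i j ∈ gaussRat) :
    A.det ∈ gaussRat := by
  rw [det_apply]
  exact sum_mem fun σ _ => by
    rw [Units.smul_def]
    exact zsmul_mem (prod_mem fun i _ => hA _ _) _

/-- By Cramer's rule. It is needed for the inverse Gram matrix in `spanProjection`. -/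
theorem inv_mem_gaussRat [DecidableEq N] {A : Matrix N N ℂ} (hA : ∀ i j, A i j ∈ gaussRat) (i j : N) :
    A⁻¹ i j ∈ gaussRat := by
  rw [inv_def, Ring.inverse_eq_inv', Matrix.smul_apply, smul_eq_mul, adjugate_apply]
  refine mul_mem (inv_mem (det_mem_gaussRat hA)) (det_mem_gaussRat fun k l => ?_)
  rw [updateRow_apply]
  split_ifs
  · rw [Pi.single_apply]
    split_ifs
    · exact one_mem _
    · exact zero_mem _
  · exact hA k l

/-- The projection onto the span of the columns of `W`, if these are linearly independent. -/
noncomputable def spanProjection [DecidableEq s] (W : Matrix N s ℂ) : Matrix N N ℂ :=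
  W * (Wᴴ * W)⁻¹ * Wᴴ

theorem isStarProjection_spanProjection [DecidableEq s] {W : Matrix N s ℂ} (hW : IsUnit (Wᴴ * W).det) :
    IsStarProjection (spanProjection W) := by
  constructor
  · have : spanProjection W * spanProjection W =
        W * ((Wᴴ * W)⁻¹ * (Wᴴ * W)) * (Wᴴ * W)⁻¹ * Wᴴ := by
      simp only [spanProjection, Matrix.mul_assoc]
    rw [IsIdempotentElem, this, nonsing_inv_mul _ hW, Matrix.mul_one, spanProjection]
  · rw [isSelfAdjoint_iff, star_eq_conjTranspose, spanProjection, conjTranspose_mul,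
      conjTranspose_mul, conjTranspose_conjTranspose, conjTranspose_nonsing_inv,
      conjTranspose_mul, conjTranspose_conjTranspose, Matrix.mul_assoc]

theorem trace_spanProjection [DecidableEq s] {W : Matrix N s ℂ} (hW : IsUnit (Wᴴ * W).det) :
    (spanProjection W).trace = Fintype.card s := by
  rw [spanProjection, Matrix.mul_assoc, trace_mul_comm, Matrix.mul_assoc,
    nonsing_inv_mul _ hW, trace_one]

theorem spanProjection_mem_gaussRat [DecidableEq s] {W : Matrix N s ℂ}
    (hW : ∀ i j, W i j ∈ gaussRat) (i j : N) :
    spanProjection W i j ∈ gaussRat := by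
  have hW' : ∀ i j, Wᴴ i j ∈ gaussRat := fun i j => star_mem_gaussRat (hW j i)
  exact mul_mem_gaussRat (mul_mem_gaussRat hW
    (inv_mem_gaussRat (mul_mem_gaussRat hW' hW))) hW' i j

theorem continuousAt_spanProjection [DecidableEq s] {W : Matrix N s ℂ} (hW : IsUnit (Wᴴ * W).det) :
    ContinuousAt spanProjection W := by
  have hgram : Continuous fun W : Matrix N s ℂ => Wᴴ * W :=
    continuous_id.matrix_conjTranspose.matrix_mul continuous_id
  have hinv : ContinuousAt (fun W : Matrix N s ℂ => (Wᴴ * W)⁻¹) W := by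
    simp only [inv_def, Ring.inverse_eq_inv']
    exact (hgram.matrix_det.continuousAt.inv₀ hW.ne_zero).smul hgram.matrix_adjugate.continuousAt
  have hmul : Continuous fun p : Matrix N s ℂ × Matrix s s ℂ => p.1 * p.2 * p.1ᴴ :=
    (continuous_fst.matrix_mul continuous_snd).matrix_mul continuous_fst.matrix_conjTranspose
  exact ContinuousAt.comp (f := fun W : Matrix N s ℂ => (W, (Wᴴ * W)⁻¹))
    (g := fun p : Matrix N s ℂ × Matrix s s ℂ => p.1 * p.2 * p.1ᴴ) hmul.continuousAt
    (continuousAt_id.prodMk hinv)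

/-- The projection onto the span of an orthonormal family can be approximated by projections of the
same rank with Gaussian rational entries. -/
theorem exists_gaussRat_projection [DecidableEq s] (A : Matrix N N ℂ) {V : Matrix N s ℂ}
    (hV : Vᴴ * V = 1) {δ : ℝ} (hδ : δ < (A * (V * Vᴴ)).trace.re) :
    ∃ P : Matrix N N ℂ, IsStarProjection P ∧ (∀ i j, P i j ∈ gaussRat) ∧
      P.trace = Fintype.card s ∧ δ < (A * P).trace.re := by
  have hdet : IsUnit (Vᴴ * V).det := by rw [hV, det_one]; exact isUnit_one
  have hspan : spanProjection V = V * Vᴴ := by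
    rw [spanProjection, hV, inv_one, Matrix.mul_one]
  have hcont : ContinuousAt (fun W => (A * spanProjection W).trace.re) V := by
    have h : Continuous fun P : Matrix N N ℂ => (A * P).trace.re :=
      Complex.continuous_re.comp (continuous_const.matrix_mul continuous_id).matrix_trace
    exact h.continuousAt.comp (continuousAt_spanProjection hdet)
  -- The columns are perturbed, not the projection, so that idempotence, self-adjointness and rank
  -- stay exact. Both conditions on `W` are open, and Gaussian rational `W` are dense.
  have h1 : ∀ᶠ W in 𝓝 V, δ < (A * spanProjection W).trace.re :=
    hcont.eventually_const_lt (by rw [← hspan] at hδ; exact hδ)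
  have h2 : ∀ᶠ W in 𝓝 V, (Wᴴ * W).det ≠ 0 := by
    have hgram : Continuous fun W : Matrix N s ℂ => (Wᴴ * W).det :=
      (continuous_id.matrix_conjTranspose.matrix_mul continuous_id).matrix_det
    exact hgram.continuousAt.eventually_ne hdet.ne_zero
  have hdense : DenseRange fun c : N → s → GaussCode => fun i j => (c i j).val :=
    DenseRange.piMap fun _ => DenseRange.piMap fun _ => denseRange_gaussCode_val
  obtain ⟨W, ⟨c, rfl⟩, hc1, hc2⟩ := mem_closure_iff_nhds.mp (hdense V) _ (h1.and h2) |>.imp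
    fun W hW => And.symm hW
  refine ⟨_, isStarProjection_spanProjection hc2.isUnit,
    spanProjection_mem_gaussRat fun i j => (c i j).val_mem_gaussRat,
    trace_spanProjection hc2.isUnit, hc1⟩

/-- The columns of `V` are the eigenvectors with index in `S`; cyclicity of the trace leaves the
block of the diagonalised `A` on `S`. -/
theorem exists_orthonormal_columns [DecidableEq N] {A : Matrix N N ℂ} (hA : A.IsHermitian) (S : Finset N) :
    ∃ V : Matrix N S ℂ, Vᴴ * V = 1 ∧
      (A * (V * Vᴴ)).trace.re = ∑ i ∈ S, hA.eigenvalues i := by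
  set U : Matrix N N ℂ := hA.eigenvectorUnitary.1 with hU
  have hUU : Uᴴ * U = 1 := Unitary.coe_star_mul_self hA.eigenvectorUnitary
  have hdiag : Uᴴ * A * U = diagonal (RCLike.ofReal ∘ hA.eigenvalues) := by
    have h := hA.conjStarAlgAut_star_eigenvectorUnitary
    rw [Unitary.conjStarAlgAut_star_apply] at h
    exact h
  have hVt : (U.submatrix id (Subtype.val : S → N))ᴴ = Uᴴ.submatrix Subtype.val id := rfl
  refine ⟨U.submatrix id Subtype.val, ?_, ?_⟩
  · rw [hVt, ← submatrix_mul _ _ _ _ _ Function.bijective_id, hUU]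
    exact submatrix_one _ Subtype.val_injective
  · have h : (U.submatrix id (Subtype.val : S → N))ᴴ * (A * U.submatrix id (Subtype.val : S → N)) =
        (diagonal (RCLike.ofReal ∘ hA.eigenvalues)).submatrix (Subtype.val : S → N) Subtype.val := by
      rw [← hdiag, Matrix.mul_assoc Uᴴ,
        submatrix_mul Uᴴ (A * U) _ id _ Function.bijective_id,
        submatrix_mul A U id id _ Function.bijective_id]
      rfl
    rw [← Matrix.mul_assoc, trace_mul_comm, h, trace, Complex.re_sum,
      ← Finset.sum_coe_sort S]
    refine Finset.sum_congr rfl fun i _ => ?_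
    rw [diag_apply, submatrix_apply, diagonal_apply_eq]
    exact Complex.ofReal_re _

end Matrices

/-- Applied to the eigenvectors with eigenvalue above `2⁻ⁿ t`: their number is controlled by
Markov's inequality, and their total weight is the tail. -/
theorem QState.exists_gaussRat_projection (ρ : QState) (n : ℕ) {t δ : ℝ} (ht : 0 < t)
    (hδ : δ < ρ.tail n t) :
    ∃ P : QMat n, IsStarProjection P ∧ (∀ i j, P i j ∈ gaussRat) ∧
      P.trace.re / 2 ^ n ≤ 1 / t ∧ δ < (ρ.mat n * P).trace.re := by
  rw [ρ.tail_eq] at hδ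
  obtain ⟨V, hV, htr⟩ := exists_orthonormal_columns (ρ.posSemidef n).isHermitian
    {i | t < 2 ^ n * (ρ.posSemidef n).isHermitian.eigenvalues i}
  obtain ⟨P, hP, hrat, hPtr, hlt⟩ := QRandom.exists_gaussRat_projection (ρ.mat n) hV (htr ▸ hδ)
  refine ⟨P, hP, hrat, ?_, hlt⟩
  rw [hPtr, Complex.natCast_re, Fintype.card_coe]
  exact ρ.card_lt_eigenvalues_le n ht

/-! ### Computability of the sum of a test. -/

theorem summable_of_le_two_inv_pow {T : ℕ → ℝ} (h0 : ∀ m, 0 ≤ T m)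
    (h1 : ∀ m, T m ≤ (2 : ℝ)⁻¹ ^ m) : Summable T :=
  Summable.of_nonneg_of_le h0 h1 (summable_geometric_of_lt_one (by norm_num) (by norm_num))

theorem isComputableReal_tsum {T : ℕ → ℝ} (hT : GaussComputable fun m => (T m : ℂ))
    (h0 : ∀ m, 0 ≤ T m) (h1 : ∀ m, T m ≤ (2 : ℝ)⁻¹ ^ m) : IsComputableReal (∑' m, T m) := by
  -- The first `n + 1` terms suffice: the remaining ones are dominated by a geometric series with
  -- sum `2⁻ⁿ`.
  obtain ⟨c, hc, hcT⟩ := (GaussComputable.sum (f := fun _ m => (T m : ℂ)) (hT.comp .snd)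
    (N := fun n : ℕ => n + 1) Computable.succ)
  obtain ⟨c1, c2, -, -, c5⟩ := GaussCode.computable_components hc
  refine ⟨fun n => ((c n).1.1, (c n).1.2, (c n).2.2), .pair c1 (.pair c2 c5), fun n => ?_⟩
  have hval : ((RatCode.val ((c n).1.1, (c n).1.2, (c n).2.2) : ℚ) : ℝ) =
      ∑ m ∈ Finset.range (n + 1), T m := by
    have h : ((c n).val).re = ∑ m ∈ Finset.range (n + 1), T m := by
      rw [hcT]
      beta_reduce
      rw [← Complex.ofReal_sum, Complex.ofReal_re]
    rw [← h, GaussCode.val_re]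
    simp [RatCode.val]
  have hs := summable_of_le_two_inv_pow h0 h1
  have hs' : Summable fun m => (2 : ℝ)⁻¹ ^ m :=
    summable_geometric_of_lt_one (by norm_num) (by norm_num)
  have hsplit := hs.sum_add_tsum_nat_add (n + 1)
  rw [hval, ← hsplit, add_sub_cancel_left,
    abs_of_nonneg (tsum_nonneg fun m => h0 (m + (n + 1)))]
  calc ∑' m, T (m + (n + 1)) ≤ ∑' m, (2 : ℝ)⁻¹ ^ (m + (n + 1)) :=
        Summable.tsum_le_tsum (fun m => h1 _) ((summable_nat_add_iff _).mpr hs)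
          ((summable_nat_add_iff _).mpr hs')
    _ = (2 : ℝ)⁻¹ ^ n := by
        simp only [pow_add]
        rw [tsum_mul_right, tsum_geometric_of_lt_one (by norm_num) (by norm_num)]
        norm_num
        ring

theorem GaussCode.isAlgebraic_val (c : GaussCode) : IsAlgebraic ℚ c.val :=
  (IsFractionRing.isAlgebraic_iff ℤ ℚ ℂ).mp
    ⟨c.toAlgCode.poly, c.toAlgCode_represents.1, c.toAlgCode_represents.2.1⟩

/-! ### Matrices coded by lists, a single type for all numbers of qubits. -/

/-- The code of the `(i, j)` entry of the matrix given by a list of codes. -/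
def entryCode (l : List GaussCode) (i j : ℕ) : GaussCode :=
  l.getD (Nat.pair i j) ((0, 0), (0, 0), 0)

theorem computable_entryCode {α : Type*} [Primcodable α] {l : α → List GaussCode} {i j : α → ℕ}
    (hl : Computable l) (hi : Computable i) (hj : Computable j) :
    Computable fun x => entryCode (l x) (i x) (j x) :=
  (Primrec.list_getD _).to_comp.comp hl (Primrec₂.natPair.to_comp.comp hi hj)

/-- The `(i, j)` entry of the matrix given by a list of codes. -/
noncomputable def entry (l : List GaussCode) (i j : ℕ) : ℂ := (entryCode l i j).val

theorem gaussComputable_entry {α : Type*} [Primcodable α] {l : α → List GaussCode} {i j : α → ℕ}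
    (hl : Computable l) (hi : Computable i) (hj : Computable j) :
    GaussComputable fun x => entry (l x) (i x) (j x) :=
  gaussComputable_val (computable_entryCode hl hi hj)

/-- The `n`-qubit matrix given by a list of codes. -/
noncomputable def codedMat (n : ℕ) (l : List GaussCode) : QMat n := fun i j => entry l i j

theorem exists_codedMat_eq {n : ℕ} {P : QMat n} (hP : ∀ i j, P i j ∈ gaussRat) :
    ∃ l, codedMat n l = P := by
  choose c hc using fun i j => exists_gaussCode_of_mem (hP i j)
  have hpos : 0 < 2 ^ n := Nat.two_pow_pos n
  let fin : ℕ → Fin (2 ^ n) := fun i => ⟨i % 2 ^ n, Nat.mod_lt _ hpos⟩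
  have hfin : ∀ i : Fin (2 ^ n), fin i = i := fun i => Fin.ext (Nat.mod_eq_of_lt i.isLt)
  -- The length exceeds `Nat.pair i j` for all indices of the matrix. Positions that belong to no
  -- entry get wrapped indices and are never read.
  refine ⟨(List.range ((2 ^ n + 1) ^ 2)).map fun q => c (fin q.unpair.1) (fin q.unpair.2), ?_⟩
  ext i j
  have hlt : Nat.pair i j < (2 ^ n + 1) ^ 2 := by
    refine (Nat.pair_lt_max_add_one_sq _ _).trans_le (Nat.pow_le_pow_left ?_ 2)
    exact Nat.succ_le_succ (max_le i.isLt.le j.isLt.le)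
  rw [codedMat, entry, entryCode, List.getD_eq_getElem?_getD, List.getElem?_map,
    List.getElem?_range hlt, Option.map_some, Option.getD_some, Nat.unpair_pair, hfin, hfin, hc]

/-- Finitely many equations between Gaussian rationals, with bounded natural indices, hence
decidable uniformly in `n`. -/
theorem isStarProjection_codedMat_iff (n : ℕ) (l : List GaussCode) :
    IsStarProjection (codedMat n l) ↔
      (∀ i < 2 ^ n, ∀ j < 2 ^ n, (starRingEnd ℂ) (entry l j i) = entry l i j) ∧
      ∀ i < 2 ^ n, ∀ j < 2 ^ n,
        ∑ k ∈ Finset.range (2 ^ n), entry l i k * entry l k j = entry l i j := by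
  rw [isStarProjection_iff, and_comm]
  refine and_congr ?_ ?_
  · rw [isSelfAdjoint_iff, ← Matrix.ext_iff]
    exact ⟨fun h i hi j hj => h ⟨i, hi⟩ ⟨j, hj⟩, fun h i j => h i i.isLt j j.isLt⟩
  · rw [IsIdempotentElem, ← Matrix.ext_iff]
    simp only [Matrix.mul_apply, codedMat, Finset.sum_range]
    exact ⟨fun h i hi j hj => h ⟨i, hi⟩ ⟨j, hj⟩, fun h i j => h i i.isLt j j.isLt⟩

theorem trace_codedMat (n : ℕ) (l : List GaussCode) :
    (codedMat n l).trace = ∑ i ∈ Finset.range (2 ^ n), entry l i i := by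
  rw [Matrix.trace, Finset.sum_range]
  rfl

section

variable {α : Type*} [Primcodable α] {n : α → ℕ} {l : α → List GaussCode}

theorem gaussComputable_trace_codedMat (hn : Computable n) (hl : Computable l) :
    GaussComputable fun x => (codedMat (n x) (l x)).trace :=
  (GaussComputable.sum (f := fun x i => entry (l x) i i)
    (gaussComputable_entry (hl.comp .fst) .snd .snd) (computable_two_pow hn)).of_eq
      fun _ => (trace_codedMat _ _).symm

theorem computablePred_isStarProjection_codedMat (hn : Computable n) (hl : Computable l) :
    ComputablePred fun x => IsStarProjection (codedMat (n x) (l x)) := by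
  have hN := computable_two_pow hn
  have hij {p : α → ℕ → ℕ → Prop} (hp : ComputablePred fun x : (α × ℕ) × ℕ => p x.1.1 x.1.2 x.2) :
      ComputablePred fun x => ∀ i < 2 ^ n x, ∀ j < 2 ^ n x, p x i j :=
    computablePred_forall_lt (p := fun x i => ∀ j < 2 ^ n x, p x i j)
      (computablePred_forall_lt (p := fun x j => p x.1 x.2 j) hp (hN.comp .fst)) hN
  have hl' : Computable fun x : (α × ℕ) × ℕ => l x.1.1 := hl.comp (.comp .fst .fst)
  have hi : Computable fun x : (α × ℕ) × ℕ => x.1.2 := .comp .snd .fst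
  have hj : Computable fun x : (α × ℕ) × ℕ => x.2 := .snd
  have he := gaussComputable_entry hl' hi hj
  refine (computablePred_and
    (hij (p := fun x i j => (starRingEnd ℂ) (entry (l x) j i) = entry (l x) i j) ?_)
    (hij (p := fun x i j =>
      ∑ k ∈ Finset.range (2 ^ n x), entry (l x) i k * entry (l x) k j = entry (l x) i j) ?_)).of_eq
    fun x => (isStarProjection_codedMat_iff (n x) (l x)).symm
  · exact (gaussComputable_entry hl' hj hi).conj.eq he
  · exact (GaussComputable.sum (f := fun (x : (α × ℕ) × ℕ) k =>
      entry (l x.1.1) x.1.2 k * entry (l x.1.1) k x.2)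
      ((gaussComputable_entry (hl'.comp .fst) (hi.comp .fst) .snd).mul
        (gaussComputable_entry (hl'.comp .fst) .snd (hj.comp .fst)))
      (hN.comp (.comp .fst .fst))).eq he

end

/-! ### Confirming a lower bound on the probability. -/

/-- A lower bound for `Tr (A B)`, computed from approximations `a` of the entries of `A` with
error at most `1 / (k + 1)`. -/
noncomputable def traceLowerBound (a : ℕ → ℕ → ℂ) (k n : ℕ) (l : List GaussCode) : ℂ :=
  ∑ i ∈ Finset.range (2 ^ n), ∑ j ∈ Finset.range (2 ^ n), (a i j * entry l j i -
    ((1 / ((k : ℝ) + 1) : ℝ) : ℂ) * (1 + ((Complex.normSq (entry l j i) : ℝ) : ℂ)))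

/-- The bound `|w| ≤ 1 + |w|²` replaces the norm, which may be irrational, by a quantity that
remains a Gaussian rational. -/
theorem abs_re_mul_sub_le {u v w : ℂ} {η : ℝ} (h : ‖u - v‖ ≤ η) :
    |(u * w).re - (v * w).re| ≤ η * (1 + Complex.normSq w) := by
  have hη : 0 ≤ η := (norm_nonneg _).trans h
  rw [← Complex.sub_re, ← sub_mul]
  refine (Complex.abs_re_le_norm _).trans ?_
  rw [norm_mul, Complex.normSq_eq_norm_sq]
  refine mul_le_mul h ?_ (norm_nonneg _) hη
  nlinarith [sq_nonneg (‖w‖ - 1), norm_nonneg w]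

theorem re_traceLowerBound (a : ℕ → ℕ → ℂ) (k n : ℕ) (l : List GaussCode) :
    (traceLowerBound a k n l).re = ∑ i : Fin (2 ^ n), ∑ j : Fin (2 ^ n),
      ((a i j * entry l j i).re - 1 / ((k : ℝ) + 1) * (1 + Complex.normSq (entry l j i))) := by
  simp only [traceLowerBound, Finset.sum_range, Complex.re_sum, Complex.sub_re,
    Complex.re_ofReal_mul, Complex.add_re, Complex.one_re, Complex.ofReal_re]

theorem re_trace_mul_codedMat {n : ℕ} (A : QMat n) (l : List GaussCode) :
    (A * codedMat n l).trace.re =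
      ∑ i : Fin (2 ^ n), ∑ j : Fin (2 ^ n), (A i j * entry l j i).re := by
  simp only [Matrix.trace, Matrix.diag_apply, Matrix.mul_apply, Complex.re_sum]
  rfl

theorem re_traceLowerBound_le {n : ℕ} {A : QMat n} {a : ℕ → ℕ → ℂ} {k : ℕ} {l : List GaussCode}
    (h : ∀ i j : Fin (2 ^ n), ‖A i j - a i j‖ < 1 / ((k : ℝ) + 1)) :
    (traceLowerBound a k n l).re ≤ (A * codedMat n l).trace.re := by
  rw [re_traceLowerBound, re_trace_mul_codedMat]
  refine Finset.sum_le_sum fun i _ => Finset.sum_le_sum fun j _ => ?_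
  have := (abs_le.mp (abs_re_mul_sub_le (w := entry l j i) (h i j).le)).1
  linarith

/-- The factor `2` counts the approximation error once as made and once as deliberately subtracted.
-/
theorem le_re_traceLowerBound {n : ℕ} {A : QMat n} {a : ℕ → ℕ → ℂ} {k : ℕ} {l : List GaussCode}
    (h : ∀ i j : Fin (2 ^ n), ‖A i j - a i j‖ < 1 / ((k : ℝ) + 1)) :
    (A * codedMat n l).trace.re - 1 / ((k : ℝ) + 1) *
      (2 * ∑ i : Fin (2 ^ n), ∑ j : Fin (2 ^ n), (1 + Complex.normSq (entry l j i))) ≤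
      (traceLowerBound a k n l).re := by
  rw [re_traceLowerBound, re_trace_mul_codedMat, Finset.mul_sum, Finset.mul_sum,
    ← Finset.sum_sub_distrib]
  refine Finset.sum_le_sum fun i _ => ?_
  rw [Finset.mul_sum, Finset.mul_sum, ← Finset.sum_sub_distrib]
  refine Finset.sum_le_sum fun j _ => ?_
  have := (abs_le.mp (abs_re_mul_sub_le (w := entry l j i) (h i j).le)).2
  linarith

/-- For a fixed matrix the loss is a constant times `1 / (k + 1)`, so a true strict inequality is
confirmed at some precision `k`. -/
theorem exists_lt_re_traceLowerBound {n : ℕ} {A : QMat n} {a : ℕ → ℕ → ℕ → ℂ} {l : List GaussCode}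
    (h : ∀ k, ∀ i j : Fin (2 ^ n), ‖A i j - a k i j‖ < 1 / ((k : ℝ) + 1)) {δ : ℝ}
    (hδ : δ < (A * codedMat n l).trace.re) : ∃ k, δ < (traceLowerBound (a k) k n l).re := by
  set C : ℝ := 2 * ∑ i : Fin (2 ^ n), ∑ j : Fin (2 ^ n), (1 + Complex.normSq (entry l j i)) with hC
  have hC0 : 0 ≤ C := mul_nonneg zero_le_two (Finset.sum_nonneg fun i _ =>
    Finset.sum_nonneg fun j _ => add_nonneg zero_le_one (Complex.normSq_nonneg _))
  obtain ⟨k, hk⟩ := exists_nat_one_div_lt (div_pos (sub_pos.mpr hδ) (by positivity : 0 < C + 1))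
  refine ⟨k, lt_of_lt_of_le ?_ (le_re_traceLowerBound (h k))⟩
  rw [lt_div_iff₀ (by positivity)] at hk
  have : (0 : ℝ) < 1 / ((k : ℝ) + 1) := by positivity
  linarith

theorem gaussComputable_traceLowerBound {α : Type*} [Primcodable α] {n k : α → ℕ}
    {l : α → List GaussCode} {a : α → ℕ → ℕ → ℂ} (hn : Computable n) (hk : Computable k)
    (hl : Computable l) (ha : GaussComputable fun x : (α × ℕ) × ℕ => a x.1.1 x.1.2 x.2) :
    GaussComputable fun x => traceLowerBound (a x) (k x) (n x) (l x) := by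
  have he : GaussComputable fun x : (α × ℕ) × ℕ => entry (l x.1.1) x.2 x.1.2 :=
    gaussComputable_entry (hl.comp (.comp .fst .fst)) .snd (.comp .snd .fst)
  have hη := gaussComputable_one_div (hk.comp (.comp .fst .fst : Computable
    fun x : (α × ℕ) × ℕ => x.1.1))
  have h1 : GaussComputable fun _ : (α × ℕ) × ℕ => (1 : ℂ) :=
    (GaussComputable.const_rat 1).of_eq fun _ => by simp
  exact GaussComputable.sum (f := fun x i => ∑ j ∈ Finset.range (2 ^ n x), (a x i j *
      entry (l x) j i - ((1 / ((k x : ℝ) + 1) : ℝ) : ℂ) *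
        (1 + ((Complex.normSq (entry (l x) j i) : ℝ) : ℂ))))
    (GaussComputable.sum (f := fun (x : α × ℕ) j => a x.1 x.2 j *
      entry (l x.1) j x.2 - ((1 / ((k x.1 : ℝ) + 1) : ℝ) : ℂ) *
        (1 + ((Complex.normSq (entry (l x.1) j x.2) : ℝ) : ℂ)))
      ((ha.mul he).sub (hη.mul (h1.add he.normSq)))
      ((computable_two_pow hn).comp .fst)) (computable_two_pow hn)

/-! ### The test that a computable state with large tails fails. -/

/-- The entries of a computable sequence of density matrices have computable approximations. -/
theorem QState.IsComputable.exists_approx {ρ : QState} (hρ : ρ.IsComputable) :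
    ∃ a : ℕ × ℕ × ℕ → ℕ → ℂ, GaussComputable (fun x : (ℕ × ℕ × ℕ) × ℕ => a x.1 x.2) ∧
      ∀ n (i j : Fin (2 ^ n)) k, ‖ρ.mat n i j - a (n, i, j) k‖ < 1 / ((k : ℝ) + 1) := by
  obtain ⟨-, code, hcode, hrep⟩ := hρ
  have hN : Computable fun x : ℕ × ℕ × ℕ => 2 ^ x.1 := computable_two_pow .fst
  -- Codes outside the matrix need not represent anything, so indices are reduced modulo `2 ^ n` to
  -- make every code valid.
  have hcode' : Computable fun x : ℕ × ℕ × ℕ => code (x.1, x.2.1 % 2 ^ x.1, x.2.2 % 2 ^ x.1) :=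
    hcode.comp (.pair .fst (.pair (Primrec.nat_mod.to_comp.comp (.comp .fst .snd) hN)
      (Primrec.nat_mod.to_comp.comp (.comp .snd .snd) hN)))
  obtain ⟨a, ha, h⟩ := exists_gaussComputable_approx hcode'
    (z := fun x => ρ.mat x.1 ⟨x.2.1 % 2 ^ x.1, Nat.mod_lt _ (Nat.two_pow_pos _)⟩
      ⟨x.2.2 % 2 ^ x.1, Nat.mod_lt _ (Nat.two_pow_pos _)⟩) fun x => hrep x.1 ⟨_, _⟩ ⟨_, _⟩
  refine ⟨a, ha, fun n i j k => ?_⟩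
  have hij := h (n, i, j) k
  have hfin : ∀ i : Fin (2 ^ n), (⟨(i : ℕ) % 2 ^ n, Nat.mod_lt _ (Nat.two_pow_pos _)⟩ :
      Fin (2 ^ n)) = i := fun i => Fin.ext (Nat.mod_eq_of_lt i.isLt)
  simpa only [hfin] using hij

/-- A computable state whose spectra do not have uniformly small tails has a computable choice of
Gaussian rational projections with small trace and large probability. -/
theorem QState.IsComputable.exists_computable_projections {ρ : QState} (hρ : ρ.IsComputable)
    {q : ℚ} (hq : ∀ t : ℝ, 0 < t → ∃ n, (q : ℝ) < ρ.tail n t) :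
    ∃ (n : ℕ → ℕ) (l : ℕ → List GaussCode), Computable n ∧ Computable l ∧ ∀ m,
      IsStarProjection (codedMat (n m) (l m)) ∧
      (codedMat (n m) (l m)).trace.re / 2 ^ n m ≤ (2 : ℝ)⁻¹ ^ m ∧
      (q : ℝ) < (ρ.mat (n m) * codedMat (n m) (l m)).trace.re := by
  obtain ⟨a, ha, happrox⟩ := hρ.exists_approx
  -- The search runs over the number of qubits, the precision `k` and the matrix. Including `k`
  -- turns the semidecidable bound on the probability into a decidable one.
  let p : ℕ → (ℕ × ℕ) × List GaussCode → Prop := fun m y =>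
    IsStarProjection (codedMat y.1.1 y.2) ∧
    ((codedMat y.1.1 y.2).trace * (2 ^ m : ℕ)).re ≤ ((2 ^ y.1.1 : ℕ) : ℂ).re ∧
    (q : ℂ).re < (traceLowerBound (fun i j => a (y.1.1, i, j) y.1.2) y.1.2 y.1.1 y.2).re
  have hp : ComputablePred fun x : ℕ × (ℕ × ℕ) × List GaussCode => p x.1 x.2 := by
    have hm : Computable fun x : ℕ × (ℕ × ℕ) × List GaussCode => x.1 := .fst
    have hn : Computable fun x : ℕ × (ℕ × ℕ) × List GaussCode => x.2.1.1 :=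
      .comp .fst (.comp .fst .snd)
    have hk : Computable fun x : ℕ × (ℕ × ℕ) × List GaussCode => x.2.1.2 :=
      .comp .snd (.comp .fst .snd)
    have hl : Computable fun x : ℕ × (ℕ × ℕ) × List GaussCode => x.2.2 := .comp .snd .snd
    refine computablePred_and (computablePred_isStarProjection_codedMat hn hl)
      (computablePred_and (((gaussComputable_trace_codedMat hn hl).mul
        (.natCast (computable_two_pow hm))).re_le (.natCast (computable_two_pow hn)))
        ((GaussComputable.const_rat q).re_lt (gaussComputable_traceLowerBound hn hk hl ?_)))
    exact ha.comp (.pair (.pair (hn.comp (.comp .fst .fst)) (.pair (.comp .snd .fst) .snd))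
      (hk.comp (.comp .fst .fst)))
  have htr : ∀ (m n : ℕ) (l : List GaussCode),
      ((codedMat n l).trace * (2 ^ m : ℕ)).re ≤ ((2 ^ n : ℕ) : ℂ).re ↔
        (codedMat n l).trace.re / 2 ^ n ≤ (2 : ℝ)⁻¹ ^ m := fun m n l => by
    rw [mul_comm, ← Complex.ofReal_natCast, Complex.re_ofReal_mul, Complex.natCast_re, inv_pow,
      div_le_iff₀ (by positivity), inv_mul_eq_div, le_div_iff₀ (by positivity), mul_comm]
    push_cast
    rfl
  have hex : ∀ m, ∃ y, p m y := fun m => by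
    -- The height `t = 2 ^ m` turns the bound `τ ≤ 1 / t` into `2⁻ᵐ`.
    obtain ⟨n, hn⟩ := hq (2 ^ m) (by positivity)
    obtain ⟨P, hP, hrat, hPtr, hlt⟩ := ρ.exists_gaussRat_projection n (by positivity) hn
    obtain ⟨l, rfl⟩ := exists_codedMat_eq hrat
    obtain ⟨k, hk⟩ := exists_lt_re_traceLowerBound
      (a := fun k i j => a (n, i, j) k) (fun k i j => happrox n i j k) hlt
    refine ⟨((n, k), l), hP, (htr m n l).mpr ?_, by simpa using hk⟩
    rwa [inv_pow, ← one_div]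
  obtain ⟨g, hg, hgp⟩ := exists_computable_choice hp hex
  refine ⟨fun m => (g m).1.1, fun m => (g m).2, .comp .fst (.comp .fst hg), .comp .snd hg,
    fun m => ?_⟩
  obtain ⟨h1, h2, h3⟩ := hgp m
  refine ⟨h1, (htr _ _ _).mp h2, lt_of_lt_of_le ?_ (re_traceLowerBound_le
    (a := fun i j => a ((g m).1.1, i, j) (g m).1.2) (k := (g m).1.2) fun i j =>
      happrox (g m).1.1 i j (g m).1.2)⟩
  simpa using h3

theorem QState.IsQuantumSchnorrRandom.hasSmallTails {ρ : QState} (hρ : ρ.IsComputable)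
    (h : ρ.IsQuantumSchnorrRandom) : ρ.HasSmallTails := by
  by_contra hcon
  unfold HasSmallTails at hcon
  push Not at hcon
  obtain ⟨δ, hδ, hcon⟩ := hcon
  -- The threshold must be rational for the search to compare with it, and strictly below `δ` to
  -- leave room for the perturbation.
  obtain ⟨q, hq0, hqδ⟩ := exists_rat_btwn hδ
  obtain ⟨n, l, hn, hl, hnl⟩ := hρ.exists_computable_projections (q := q) fun t ht =>
    (hcon t ht).imp fun _ h => hqδ.trans_le h
  let S : ℕ → SpecialProjection := fun m =>
    ⟨n m, codedMat (n m) (l m), (hnl m).1, fun _ _ => GaussCode.isAlgebraic_val _⟩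
  have hnonneg : ∀ m, 0 ≤ (S m).tau := fun m => by
    refine div_nonneg ?_ (by positivity)
    rw [Matrix.trace, Complex.re_sum]
    exact Finset.sum_nonneg fun i _ => (isStarProjection_diag (S m).isStarProjection i).1
  have hle : ∀ m, (S m).tau ≤ (2 : ℝ)⁻¹ ^ m := fun m => (hnl m).2.1
  have htau : GaussComputable fun m => ((S m).tau : ℂ) :=
    ((gaussComputable_trace_codedMat hn hl).re.mul
      ((GaussComputable.const_rat (1 / 2)).pow hn)).of_eq fun m => by
        simp only [S, SpecialProjection.tau]
        push_cast
        rw [one_div, inv_pow, div_eq_mul_inv]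
  have hS : IsQSTest S :=
    { computable := ⟨hn, fun x => (entryCode (l x.1) x.2.1 x.2.2).toAlgCode,
        GaussCode.computable_toAlgCode.comp (computable_entryCode (hl.comp .fst)
          (.comp .fst .snd) (.comp .snd .snd)),
        fun m i j => GaussCode.toAlgCode_represents _⟩
      sum_computable := ⟨_, (summable_of_le_two_inv_pow hnonneg hle).hasSum,
        isComputableReal_tsum htau hnonneg hle⟩ }
  refine h S hS q hq0 ?_
  have : {m : ℕ | (q : ℝ) < ρ.prob (S m)} = Set.univ := Set.eq_univ_of_forall fun m => (hnl m).2.2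
  rw [FailsAt, this]
  exact Set.infinite_univ

end QRandom

theorem theorem7p1 :
    (∀ ρ : QRandom.QState, ρ.IsComputable →
      (ρ.IsQuantumSchnorrRandom ↔ QRandom.UniformlyIntegrableUnit ρ.family)) ∧
    (∀ ρ : QRandom.QState, QRandom.UniformlyIntegrableUnit ρ.family →
      ρ.IsStrongQuantumRandom ∧ ρ.IsQuantumSchnorrRandom) := by
  simp only [QRandom.QState.uniformlyIntegrable_iff_hasSmallTails]
  exact ⟨fun ρ hρ => ⟨fun h => h.hasSmallTails hρ, fun h => h.isQuantumSchnorrRandom⟩,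
    fun ρ h => ⟨h.isStrongQuantumRandom, h.isQuantumSchnorrRandom⟩⟩
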